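/- Let $\pi$ and $q$ be probability measures on a measurable space $\mathbb X$ with $\pi\ll q$, let $\omega=d\pi/dq$ and assume $\omega>0$ $q$-almost everywhere. Let $f:\mathbb X\to\mathbb R$ be measurable, and write $\mu(g)=\int g\,d\mu$. For $N\ge 1$ let $\bar q=q^{\otimes N}$ and, for $\mathbf x=(x_1,\dots,x_N)\in\mathbb X^N$, $$\hat Z(\mathbf x)=\frac1N\sum_{n=1}^N\omega(x_n),\qquad \hat F(\mathbf x)=\frac{\sum_{n=1}^N\omega(x_n)f(x_n)}{\sum_{n=1}^N\omega(x_n)}.$$ The importance sampling (IS) estimator of $\pi(f)$ is $\hat F(\mathbf x)$ with $\mathbf x\sim\bar q$. The unbiased importance sampling (UIS) estimator $\hat F_u$ is defined from independent draws $\mathbf x_0\sim\bar q$, $\mathbf y_0\sim\bar q$, $\mathbf x^\star_t\sim\bar q$ $(t\ge1)$ and $u_t\sim\mathrm{Uniform}(0,1)$ $(t\ge0)$ as follows. Set $\mathbf x_1=\mathbf y_0$ if $u_0<\hat Z(\mathbf y_0)/\hat Z(\mathbf x_0)$ and $\mathbf x_1=\mathbf x_0$ otherwise. For $t\ge1$,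 set $\mathbf x_{t+1}=\mathbf x^\star_t$ if $u_t<\hat Z(\mathbf x^\star_t)/\hat Z(\mathbf x_t)$ and $\mathbf x_{t+1}=\mathbf x_t$ otherwise; and set $\mathbf y_t=\mathbf x^\star_t$ if $u_t<\hat Z(\mathbf x^\star_t)/\hat Z(\mathbf y_{t-1})$ and $\mathbf y_t=\mathbf y_{t-1}$ otherwise. Let $\tau=\inf\{t\ge1:\mathbf x_t=\mathbf y_{t-1}\}$ and $$\hat F_u=\hat F(\mathbf x_0)+\sum_{t=1}^{\tau-1}\{\hat F(\mathbf x_t)-\hat F(\mathbf y_{t-1})\}.$$ Suppose that $p\in(2,\infty)$ satisfies $q(\omega^p)<\infty$, that $q(f^2\omega^2)<\infty$, and that either there is $r\in(2,\infty)$ with $q(|f|^r)<\infty$ and $2p+4r+4<rp$, or (the case $r=\infty$) $f$ is $q$-essentially bounded and $p>4$. Then, for every $N\ge1$, $\tau<\infty$ almost surely and the mean squared errors of $\hat F_u$ and of $\hat F(\mathbf x)$ are finite; moreover both of the following limits exist in $\mathbb R$, and they are equal: $$\lim_{N\to\infty}N\cdot\mathbb E\left[(\hat F_u-\pi(f))^2\right]=\lim_{N\to\infty}N\cdot\mathbb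 E_{\mathbf x\sim\bar q}\left[(\hat F(\mathbf x)-\pi(f))^2\right].$$ -/

import Mathlib

open MeasureTheory Filter Topology
open scoped ENNReal

namespace UIS

noncomputable section

variable {X : Type*} {N : ℕ}

/-- The average weight `Ẑ(x) = N⁻¹ ∑ ω(xₙ)` of `N` particles. -/
def zHat (ω : X → ℝ) (x : Fin N → X) : ℝ :=
  (N : ℝ)⁻¹ * ∑ n, ω (x n)

/-- The self-normalized importance sampling estimator
`F̂(x) = ∑ ω(xₙ) f(xₙ) / ∑ ω(xₙ)`. -/
def fHat (ω f : X → ℝ) (x : Fin N → X) : ℝ :=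
  (∑ n, ω (x n) * f (x n)) / ∑ n, ω (x n)

/-- One step of particle independent Metropolis-Hastings from the state `x`, with
proposal `xs` and uniform draw `u`. -/
def pimhStep (ω : X → ℝ) (x xs : Fin N → X) (u : unitInterval) : Fin N → X :=
  if (u : ℝ) < zHat ω xs / zHat ω x then xs else x

/-- One step of the common draws coupling: both components use the same proposal and the
same uniform. -/
def coupledStep (ω : X → ℝ) (xy : (Fin N → X) × (Fin N → X))
    (d : (Fin N → X) × unitInterval) : (Fin N → X) × (Fin N → X) :=
  (pimhStep ω xy.1 d.1 d.2, pimhStep ω xy.2 d.1 d.2)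

/-- All the random inputs of the coupled chains: the initial state `x₀`, then a sequence of
pairs (proposal, uniform). The proposal in the pair of index `0` is the state `y₀`. -/
abbrev Draws (X : Type*) (N : ℕ) : Type _ :=
  (Fin N → X) × (ℕ → (Fin N → X) × unitInterval)

/-- The law `q̄` of `N` independent particles from `q`. -/
def qBar [MeasurableSpace X] (q : Measure X) (N : ℕ) : Measure (Fin N → X) :=
  Measure.pi fun _ => q

instance [MeasurableSpace X] (q : Measure X) [IsProbabilityMeasure q] (N : ℕ) :
    IsProbabilityMeasure (qBar q N) := by
  unfold qBar; infer_instance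

/-- The law of the random inputs: all of them independent, the states with law `q̄`
and the uniforms with the uniform law on `[0,1]`. -/
def drawsLaw [MeasurableSpace X] (q : Measure X) [IsProbabilityMeasure q] (N : ℕ) :
    Measure (Draws X N) :=
  (qBar q N).prod (Measure.infinitePi fun _ : ℕ => (qBar q N).prod (volume : Measure unitInterval))

/-- The coupled chains with a lag of one: the term of index `t` is `(x_{t+1}, y_t)`. -/
def laggedPair (ω : X → ℝ) (z : Draws X N) : ℕ → (Fin N → X) × (Fin N → X)
  | 0 => (pimhStep ω z.1 (z.2 0).1 (z.2 0).2, (z.2 0).1)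
  | t + 1 => coupledStep ω (laggedPair ω z t) (z.2 (t + 1))

/-- The chain `(x_t)`. -/
def chainX (ω : X → ℝ) (z : Draws X N) : ℕ → (Fin N → X)
  | 0 => z.1
  | t + 1 => (laggedPair ω z t).1

/-- The chain `(y_t)`. -/
def chainY (ω : X → ℝ) (z : Draws X N) (t : ℕ) : Fin N → X :=
  (laggedPair ω z t).2

/-- The meeting time `τ = inf {t ≥ 1 : x_t = y_{t-1}}`, equal to `⊤` if there is no meeting. -/
def meetingTime (ω : X → ℝ) (z : Draws X N) : ℕ∞ :=
  ⨅ (t : ℕ) (_ : 1 ≤ t ∧ chainX ω z t = chainY ω z (t - 1)), (t : ℕ∞)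

/-- The unbiased estimator `F̂(x₀) + ∑_{t=1}^{τ-1} (F̂(x_t) - F̂(y_{t-1}))`, on the event
`τ < ⊤` (the sum is set to `0` where `τ = ⊤`). -/
def uis (ω f : X → ℝ) (z : Draws X N) : ℝ :=
  fHat ω f (chainX ω z 0) + ∑ t ∈ Finset.Ico 1 (meetingTime ω z).toNat,
    (fHat ω f (chainX ω z t) - fHat ω f (chainY ω z (t - 1)))

end

end UIS

/-! ### Moments of sums of independent centred variables. -/

namespace UIS

open ProbabilityTheory

/-! Write c = π(f), h = F̂ - c, Z = Ẑ, and let A be the mean of the ω(xₙ)(f(xₙ) - c).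
Self-normalization gives hZ = A, hence h = A - h(Z - 1). The terms of A are independent and centred,
so N·E[A²] = q(ω²(f - c)²) for every N ≥ 1, and this number is the common limit. All other
contributions are negligible in mean square, and a negligible perturbation does not affect the limit
(`tendsto_mul_integral_add_sq`).

For importance sampling it remains to see that N·E[h²(Z - 1)²] → 0. Where Z is near 1, h² is
comparable to A². Elsewhere Z may be close to 0, and the only control on h is E|h|^r ≤ N·q(|f -
c|^r), by convexity. Young's inequality trades this against E[(Z - 1)^(2k)] = O(N^(-k))
(`exists_moment_bound`), where 2k ≤ p. The condition r + 2 < k(r - 2), which follows from the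
hypothesis on p and r, makes the trade succeed (`tendsto_mul_integral_err_sq_mul_rpow`).

For the unbiased estimator, consider the correction F̂_u - F̂(x₀). While the first chain rejects, it
stays at x₀ and the second chain sits at one of the rejected proposals, whose average weight is at
most Z(x₀). A proposal accepted by the first chain is therefore accepted by the second, and the
chains have met. So the correction is a sum over the initial run of rejections only
(`sq_uis_sub_le`). Given x₀ the length of this run is geometric, with rejection probability ρ(x₀).
Two bounds on ρ are used: 1 - ρ ≥ 3/(4(Z(x₀) + 1 + V)), with V a bound on E[(Z - 1)²], makes the
sums over the run polynomial in Z(x₀); and ρ ≤ |Z(x₀) - 1| + E|Z - 1| makes them small. The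
resulting conditional second moment (`lintegral_steps_sq_le`) involves only E[h²], E[h²|Z - 1|], E|Z
- 1| and the state-dependent h²|Z - 1|^j (j ≤ 2), |Z - 1| and (Z - 1)⁴. Integrated over x₀ and
multiplied by N it tends to 0. -/

lemma abs_pow_le_one_add {n m : ℕ} (h : m ≤ 2 * n) (s : ℝ) : |s| ^ m ≤ 1 + s ^ (2 * n) := by
  rw [← (even_two_mul n).pow_abs]
  rcases le_total |s| 1 with hs | hs
  · have : |s| ^ m ≤ 1 := pow_le_one₀ (abs_nonneg s) hs
    have : 0 ≤ |s| ^ (2 * n) := by positivity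
    linarith
  · have := pow_le_pow_right₀ hs h
    linarith

/-- A second order expansion of an even power. -/
lemma add_pow_even_le (n : ℕ) (s h : ℝ) :
    (s + h) ^ (2 * (n + 1)) ≤ s ^ (2 * (n + 1)) + (2 * (n + 1) : ℕ) * (s ^ (2 * n + 1) * h) +
      4 ^ (n + 1) * ((1 + s ^ (2 * n)) * (1 + h ^ (2 * (n + 1)))) := by
  -- These are the binomial terms with at least two factors `h`; the binomial coefficients sum to at
  -- most 4^(n+1).
  have key : ∑ m ∈ Finset.range (2 * n + 1),
      s ^ m * h ^ (2 * (n + 1) - m) * ((2 * (n + 1)).choose m : ℝ) ≤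
      4 ^ (n + 1) * ((1 + s ^ (2 * n)) * (1 + h ^ (2 * (n + 1)))) := by
    have hs0 : 0 ≤ s ^ (2 * n) := (even_two_mul n).pow_nonneg s
    have hh0 : 0 ≤ h ^ (2 * (n + 1)) := (even_two_mul (n + 1)).pow_nonneg h
    calc _ ≤ ∑ m ∈ Finset.range (2 * n + 1),
          ((1 + s ^ (2 * n)) * (1 + h ^ (2 * (n + 1)))) * ((2 * (n + 1)).choose m : ℝ) := by
          refine Finset.sum_le_sum fun m hm => ?_
          refine mul_le_mul_of_nonneg_right ?_ (Nat.cast_nonneg _)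
          refine (le_abs_self _).trans ?_
          rw [abs_mul, abs_pow, abs_pow]
          have hm' := Finset.mem_range.1 hm
          exact mul_le_mul (abs_pow_le_one_add (by omega) s) (abs_pow_le_one_add (by omega) h)
            (by positivity) (by positivity)
      _ = ((1 + s ^ (2 * n)) * (1 + h ^ (2 * (n + 1)))) *
            ∑ m ∈ Finset.range (2 * n + 1), ((2 * (n + 1)).choose m : ℝ) := by
          rw [Finset.mul_sum]
      _ ≤ ((1 + s ^ (2 * n)) * (1 + h ^ (2 * (n + 1)))) * 4 ^ (n + 1) := by
          refine mul_le_mul_of_nonneg_left ?_ (by positivity)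
          have h1 : ∑ m ∈ Finset.range (2 * (n + 1) + 1), ((2 * (n + 1)).choose m : ℝ) =
              4 ^ (n + 1) := by
            have := Nat.sum_range_choose (2 * (n + 1))
            rw [pow_mul] at this
            exact_mod_cast this
          rw [← h1]
          exact Finset.sum_le_sum_of_subset_of_nonneg
            (Finset.range_subset_range.2 (by omega)) fun _ _ _ => Nat.cast_nonneg _
      _ = _ := by ring
  rw [add_pow, show 2 * (n + 1) + 1 = 2 * n + 1 + 1 + 1 by ring, Finset.sum_range_succ,
    Finset.sum_range_succ]
  have e1 : 2 * (n + 1) - (2 * n + 1) = 1 := by omega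
  have e2 : 2 * (n + 1) - (2 * n + 1 + 1) = 0 := by omega
  have e3 : (2 * (n + 1)).choose (2 * n + 1) = 2 * (n + 1) := by
    rw [show 2 * (n + 1) = 2 * n + 1 + 1 by ring, Nat.choose_succ_self_right]
  have e4 : (2 * (n + 1)).choose (2 * n + 1 + 1) = 1 := by
    rw [show 2 * (n + 1) = 2 * n + 1 + 1 by ring, Nat.choose_self]
  rw [e1, e2, e3, e4, show 2 * n + 1 + 1 = 2 * (n + 1) by ring, pow_zero, pow_one, Nat.cast_one]
  linarith [key]

variable {X : Type*} [MeasurableSpace X] {q : Measure X} [IsProbabilityMeasure q]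

lemma memLp_integrable_pow {Ω : Type*} [MeasurableSpace Ω] {μ : Measure Ω} [IsFiniteMeasure μ]
    {g : Ω → ℝ} {n m : ℕ} (hg : MemLp g (n : ℕ) μ) (h : m ≤ n) :
    Integrable (fun x => g x ^ m) μ := by
  have h1 : MemLp g (m : ℕ) μ := hg.mono_exponent (by exact_mod_cast h)
  have h2 := h1.integrable_norm_pow'
  refine h2.mono (h1.1.pow m) (Eventually.of_forall fun x => ?_)
  simp

lemma measurePreserving_eval_qBar (q : Measure X) [IsProbabilityMeasure q] {N : ℕ} (n : Fin N) :
    MeasurePreserving (fun x : Fin N → X => x n) (qBar q N) q :=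
  measurePreserving_eval (fun _ : Fin N => q) n

lemma integral_eval_qBar {φ : X → ℝ} (hφ : Measurable φ) {N : ℕ} (n : Fin N) :
    ∫ x, φ (x n) ∂(qBar q N) = ∫ x, φ x ∂q := by
  have mp := measurePreserving_eval_qBar q n
  have := integral_map (μ := qBar q N) mp.measurable.aemeasurable
    (f := φ) hφ.aestronglyMeasurable
  rw [mp.map_eq] at this
  exact this.symm

/-- Even moments of sums of independent centred variables. -/
lemma exists_moment_bound {φ : X → ℝ} (hφ : Measurable φ) (k : ℕ)
    (hL : MemLp φ ((2 * k : ℕ) : ℝ≥0∞) q) (h0 : ∫ x, φ x ∂q = 0) :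
    ∃ C : ℝ, 0 ≤ C ∧ ∀ (N : ℕ) (s : Finset (Fin N)),
      ∫ x, (∑ n ∈ s, φ (x n)) ^ (2 * k) ∂(qBar q N) ≤ C * (s.card : ℝ) ^ k := by
  induction k with
  | zero => exact ⟨1, zero_le_one, fun N s => by simp⟩
  | succ k ih =>
    obtain ⟨C, hC, hb⟩ := ih (hL.mono_exponent (by exact_mod_cast (by omega)))
    set c := ∫ x, φ x ^ (2 * (k + 1)) ∂q with hc
    have hc0 : 0 ≤ c := integral_nonneg fun x => (even_two_mul _).pow_nonneg _
    set K := 4 ^ (k + 1) * ((1 + C) * (1 + c)) with hK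
    have hK0 : 0 ≤ K := by positivity
    refine ⟨K, hK0, fun N s => ?_⟩
    have mp := fun n : Fin N => measurePreserving_eval_qBar q n
    have hLn : ∀ n : Fin N, MemLp (fun x : Fin N → X => φ (x n)) ((2 * (k + 1) : ℕ) : ℝ≥0∞)
        (qBar q N) := fun n => hL.comp_measurePreserving (mp n)
    have hind : iIndepFun (fun (n : Fin N) (x : Fin N → X) => φ (x n)) (qBar q N) :=
      iIndepFun_pi fun _ => hφ.aemeasurable
    -- Adding one variable raises the moment of order 2(k+1) by O(|s|^k), so |s| additions give
    -- O(|s|^(k+1)).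
    induction s using Finset.cons_induction with
    | empty => simp
    | cons n s hn ih =>
      have hS : MemLp (fun x : Fin N → X => ∑ n ∈ s, φ (x n)) ((2 * (k + 1) : ℕ) : ℝ≥0∞)
          (qBar q N) := memLp_finsetSum s fun n _ => hLn n
      have hSn : IndepFun (fun x : Fin N → X => ∑ n ∈ s, φ (x n)) (fun x => φ (x n))
          (qBar q N) := by
        have := hind.indepFun_finsetSum_of_notMem (fun i => hφ.comp (measurable_pi_apply i)) hn
        convert this using 1
        ext x; simp
      set S := fun x : Fin N → X => ∑ n ∈ s, φ (x n) with hSdef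
      have hpt : ∀ x : Fin N → X, (∑ m ∈ Finset.cons n s hn, φ (x m)) ^ (2 * (k + 1)) ≤
          S x ^ (2 * (k + 1)) + (2 * (k + 1) : ℕ) * (S x ^ (2 * k + 1) * φ (x n)) +
          4 ^ (k + 1) * ((1 + S x ^ (2 * k)) * (1 + φ (x n) ^ (2 * (k + 1)))) := fun x => by
        rw [Finset.sum_cons, add_comm]
        exact add_pow_even_le k _ _
      have i1 : Integrable (fun x => S x ^ (2 * (k + 1))) (qBar q N) :=
        memLp_integrable_pow hS le_rfl
      have i2 : Integrable (fun x => S x ^ (2 * k + 1)) (qBar q N) :=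
        memLp_integrable_pow hS (by omega)
      have i3 : Integrable (fun x => S x ^ (2 * k)) (qBar q N) :=
        memLp_integrable_pow hS (by omega)
      have j1 : Integrable (fun x : Fin N → X => φ (x n)) (qBar q N) := by
        simpa using memLp_integrable_pow (m := 1) (hLn n) (by omega)
      have j2 : Integrable (fun x : Fin N → X => φ (x n) ^ (2 * (k + 1))) (qBar q N) :=
        memLp_integrable_pow (hLn n) le_rfl
      have v1 : ∫ x : Fin N → X, φ (x n) ∂(qBar q N) = 0 := by
        rw [integral_eval_qBar hφ n, h0]
      have v2 : ∫ x : Fin N → X, φ (x n) ^ (2 * (k + 1)) ∂(qBar q N) = c :=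
        integral_eval_qBar (hφ.pow_const _) n
      have ind1 : IndepFun (fun x => S x ^ (2 * k + 1)) (fun x => φ (x n)) (qBar q N) :=
        hSn.comp (φ := fun y => y ^ (2 * k + 1)) (ψ := id) (by fun_prop) measurable_id
      have ind2 : IndepFun (fun x => 1 + S x ^ (2 * k)) (fun x => 1 + φ (x n) ^ (2 * (k + 1)))
          (qBar q N) :=
        hSn.comp (φ := fun y => 1 + y ^ (2 * k)) (ψ := fun y => 1 + y ^ (2 * (k + 1)))
          (by fun_prop) (by fun_prop)
      have k1 : Integrable (fun x => S x ^ (2 * k + 1) * φ (x n)) (qBar q N) :=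
        ind1.integrable_mul i2 j1
      have k2 : Integrable
          (fun x => (1 + S x ^ (2 * k)) * (1 + φ (x n) ^ (2 * (k + 1)))) (qBar q N) :=
        ind2.integrable_mul ((integrable_const 1).add i3)
        ((integrable_const 1).add j2)
      have w1 := ind1.integral_fun_mul_eq_mul_integral i2.1 j1.1
      have w2 := ind2.integral_fun_mul_eq_mul_integral ((integrable_const 1).add i3).1
        ((integrable_const 1).add j2).1
      calc _ ≤ ∫ x, (S x ^ (2 * (k + 1)) + (2 * (k + 1) : ℕ) * (S x ^ (2 * k + 1) * φ (x n)) +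
          4 ^ (k + 1) * ((1 + S x ^ (2 * k)) * (1 + φ (x n) ^ (2 * (k + 1))))) ∂(qBar q N) := by
            refine integral_mono ?_ ((i1.add (k1.const_mul _)).add (k2.const_mul _)) hpt
            exact memLp_integrable_pow (memLp_finsetSum _ fun n _ => hLn n) le_rfl
        -- The first-order term vanishes: `φ (x n)` is centred and independent of `S`.
        _ = (∫ x, S x ^ (2 * (k + 1)) ∂(qBar q N)) + 4 ^ (k + 1) *
              ((1 + ∫ x, S x ^ (2 * k) ∂(qBar q N)) * (1 + c)) := by
            have k3 : Integrable (fun x => S x ^ (2 * (k + 1)) +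
                (2 * (k + 1) : ℕ) * (S x ^ (2 * k + 1) * φ (x n))) (qBar q N) :=
              i1.add (k1.const_mul _)
            rw [integral_add k3 (k2.const_mul _), integral_add i1 (k1.const_mul _), integral_const_mul, integral_const_mul, w1, w2,
              v1, integral_add (integrable_const 1) i3, integral_add (integrable_const 1) j2, v2]
            simp
        _ ≤ K * (s.card : ℝ) ^ (k + 1) + 4 ^ (k + 1) * ((1 + C * (s.card : ℝ) ^ k) * (1 + c)) := by
            gcongr
            exact hb N s
        _ ≤ K * (s.card : ℝ) ^ (k + 1) + K * ((s.card : ℝ) + 1) ^ k := by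
            have t1 : (1 : ℝ) ≤ ((s.card : ℝ) + 1) ^ k :=
              one_le_pow₀ (by linarith [Nat.cast_nonneg (α := ℝ) s.card])
            have t2 : (s.card : ℝ) ^ k ≤ ((s.card : ℝ) + 1) ^ k := by gcongr; linarith
            have : 1 + C * (s.card : ℝ) ^ k ≤ (1 + C) * ((s.card : ℝ) + 1) ^ k := by
              nlinarith
            have : 4 ^ (k + 1) * ((1 + C * (s.card : ℝ) ^ k) * (1 + c)) ≤
                4 ^ (k + 1) * (((1 + C) * ((s.card : ℝ) + 1) ^ k) * (1 + c)) := by gcongr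
            rw [hK]
            linarith
        _ ≤ K * ((Finset.cons n s hn).card : ℝ) ^ (k + 1) := by
            rw [Finset.card_cons, ← mul_add]
            refine mul_le_mul_of_nonneg_left ?_ hK0
            push_cast
            rw [pow_succ, pow_succ]
            have t2 : (s.card : ℝ) ^ k ≤ ((s.card : ℝ) + 1) ^ k := by gcongr; linarith
            nlinarith [Nat.cast_nonneg (α := ℝ) s.card]

/-- The second moment of the mean of independent centred variables. -/
lemma mul_integral_sq_mean {φ : X → ℝ} (hφ : Measurable φ) (hL : MemLp φ 2 q)
    (h0 : ∫ x, φ x ∂q = 0) {N : ℕ} (hN : 1 ≤ N) :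
    N * ∫ x, ((N : ℝ)⁻¹ * ∑ n, φ (x n)) ^ 2 ∂(qBar q N) = ∫ x, φ x ^ 2 ∂q := by
  have hN' : (N : ℝ) ≠ 0 := by positivity
  have hv := variance_sum_pi (ι := Fin N) (μ := fun _ => q) (X := fun _ => φ) (fun _ => hL)
  have mp := fun n : Fin N => measurePreserving_eval_qBar q n
  have hLn : ∀ n : Fin N, MemLp (fun x : Fin N → X => φ (x n)) 2 (qBar q N) :=
    fun n => hL.comp_measurePreserving (mp n)
  have hint : ∫ x, (∑ n : Fin N, fun x : Fin N → X => φ (x n)) x ∂(qBar q N) = 0 := by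
    simp only [Finset.sum_apply]
    rw [integral_finsetSum _ fun n _ => (hLn n).integrable (by norm_num)]
    refine Finset.sum_eq_zero fun n _ => ?_
    rw [integral_eval_qBar hφ n, h0]
  rw [show (Measure.pi fun _ : Fin N => q) = qBar q N from rfl,
    variance_of_integral_eq_zero
      (by exact (memLp_finsetSum' _ fun n _ => hLn n).1.aemeasurable) hint] at hv
  simp only [variance_of_integral_eq_zero hφ.aemeasurable h0, Finset.sum_const, Finset.card_univ,
    Fintype.card_fin, nsmul_eq_mul, Finset.sum_apply] at hv
  simp only [mul_pow, integral_const_mul]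
  rw [hv]
  field_simp

end UIS

/-! ### Negligible perturbations and pointwise inequalities for the self-normalized estimator. -/

namespace UIS

open ProbabilityTheory

/-- The constant `K δ` may blow up as δ → 0: δ is fixed before N → ∞, so only δL survives in the
limit. -/
lemma tendsto_zero_of_forall_delta {x a b : ℕ → ℝ} {L : ℝ} (K : ℝ → ℝ)
    (hx : ∀ᶠ N in atTop, 0 ≤ x N) (ha : Tendsto a atTop (𝓝 L)) (hb : Tendsto b atTop (𝓝 0))
    (h : ∀ δ : ℝ, 0 < δ → δ ≤ 1 / 2 → ∀ᶠ N in atTop, x N ≤ δ * a N + K δ * b N) :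
    Tendsto x atTop (𝓝 0) := by
  refine tendsto_order.2 ⟨fun y hy => hx.mono fun N hN => hy.trans_le hN, fun ε hε => ?_⟩
  set δ := min (1 / 2) (ε / (2 * (|L| + 1))) with hδ
  have hδ0 : 0 < δ := lt_min (by norm_num) (by positivity)
  have hlim : Tendsto (fun N => δ * a N + K δ * b N) atTop (𝓝 (δ * L + K δ * 0)) :=
    (ha.const_mul _).add (hb.const_mul _)
  have hlt : δ * L + K δ * 0 < ε := by
    have h1 : δ * (2 * (|L| + 1)) ≤ ε := by
      have := min_le_right (1 / 2) (ε / (2 * (|L| + 1)))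
      rwa [← hδ, le_div_iff₀ (by positivity)] at this
    nlinarith [le_abs_self L, abs_nonneg L]
  filter_upwards [h δ hδ0 (min_le_left _ _), hlim.eventually_lt_const hlt] with N h1 h2
  exact h1.trans_lt h2

section Sequences

variable {Ω : ℕ → Type*} [∀ N, MeasurableSpace (Ω N)] {μ : ∀ N, Measure (Ω N)} {c : ℕ → ℝ}

/-- A perturbation which is negligible in mean square does not change the limit of the rescaled
mean squares. -/
lemma tendsto_mul_integral_add_sq (hc : ∀ N, 0 ≤ c N) {A E : ∀ N, Ω N → ℝ} {L : ℝ}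
    (hA : ∀ᶠ N in atTop, MemLp (A N) 2 (μ N)) (hE : ∀ᶠ N in atTop, MemLp (E N) 2 (μ N))
    (hAL : Tendsto (fun N => c N * ∫ x, A N x ^ 2 ∂(μ N)) atTop (𝓝 L))
    (hE0 : Tendsto (fun N => c N * ∫ x, E N x ^ 2 ∂(μ N)) atTop (𝓝 0)) :
    Tendsto (fun N => c N * ∫ x, (A N x + E N x) ^ 2 ∂(μ N)) atTop (𝓝 L) := by
  have key : Tendsto (fun N => |c N * ∫ x, (A N x + E N x) ^ 2 ∂(μ N) -
      c N * ∫ x, A N x ^ 2 ∂(μ N)|) atTop (𝓝 0) := by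
    refine tendsto_zero_of_forall_delta (fun δ => 1 + 1 / δ)
      (Eventually.of_forall fun _ => abs_nonneg _) hAL hE0 fun δ hδ _ => ?_
    filter_upwards [hA, hE] with N hAN hEN
    have iA := hAN.integrable_sq
    have iE := hEN.integrable_sq
    have iS : Integrable (fun x => (A N x + E N x) ^ 2) (μ N) := (hAN.add hEN).integrable_sq
    rw [← mul_sub, ← integral_sub iS iA, abs_mul, abs_of_nonneg (hc N)]
    have : |∫ x, ((A N x + E N x) ^ 2 - A N x ^ 2) ∂(μ N)| ≤
        ∫ x, (δ * A N x ^ 2 + (1 + 1 / δ) * E N x ^ 2) ∂(μ N) := by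
      refine abs_integral_le_integral_abs.trans (integral_mono (iS.sub iA).abs
        ((iA.const_mul _).add (iE.const_mul _)) fun x => ?_)
      have e : (1 + 1 / δ) * E N x ^ 2 = E N x ^ 2 + E N x ^ 2 / δ := by ring
      -- The two squares give 2|AE| ≤ δA² + E²/δ.
      have h1 : 0 ≤ δ * (A N x - E N x / δ) ^ 2 := by positivity
      have h2 : 0 ≤ δ * (A N x + E N x / δ) ^ 2 := by positivity
      have e1 : δ * (A N x - E N x / δ) ^ 2 =
          δ * A N x ^ 2 - 2 * A N x * E N x + E N x ^ 2 / δ := by field_simp; ring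
      have e2 : δ * (A N x + E N x / δ) ^ 2 =
          δ * A N x ^ 2 + 2 * A N x * E N x + E N x ^ 2 / δ := by field_simp; ring
      simp only []
      rw [e, abs_le]
      constructor <;> nlinarith [sq_nonneg (E N x)]
    rw [integral_add (iA.const_mul _) (iE.const_mul _), integral_const_mul,
      integral_const_mul] at this
    calc _ ≤ c N * _ := mul_le_mul_of_nonneg_left this (hc N)
      _ = _ := by ring
  have := (tendsto_zero_iff_abs_tendsto_zero _).2 key
  simpa using this.add hAL

/-- An intermediate first moment, obtained from |W| ≤ δ + W²/δ under the weight u. It is applied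
with u = h² and with u = 1. -/
lemma tendsto_mul_integral_mul_abs (hc : ∀ N, 0 ≤ c N) {u W : ∀ N, Ω N → ℝ} {L : ℝ}
    (hu : ∀ N x, 0 ≤ u N x)
    (i0 : ∀ᶠ N in atTop, Integrable (u N) (μ N))
    (i1 : ∀ᶠ N in atTop, Integrable (fun x => u N x * |W N x|) (μ N))
    (i2 : ∀ᶠ N in atTop, Integrable (fun x => u N x * W N x ^ 2) (μ N))
    (h0 : Tendsto (fun N => c N * ∫ x, u N x ∂(μ N)) atTop (𝓝 L))
    (h2 : Tendsto (fun N => c N * ∫ x, u N x * W N x ^ 2 ∂(μ N)) atTop (𝓝 0)) :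
    Tendsto (fun N => c N * ∫ x, u N x * |W N x| ∂(μ N)) atTop (𝓝 0) := by
  refine tendsto_zero_of_forall_delta (fun δ => 1 / δ) (Eventually.of_forall fun N =>
    mul_nonneg (hc N) (integral_nonneg fun x => mul_nonneg (hu N x) (abs_nonneg _))) h0 h2
    fun δ hδ _ => ?_
  filter_upwards [i0, i1, i2] with N j0 j1 j2
  have : ∫ x, u N x * |W N x| ∂(μ N) ≤
      ∫ x, (δ * u N x + 1 / δ * (u N x * W N x ^ 2)) ∂(μ N) := by
    refine integral_mono j1 ((j0.const_mul _).add (j2.const_mul _)) fun x => ?_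
    have h1 : |W N x| ≤ δ + 1 / δ * W N x ^ 2 := by
      have : 0 ≤ (1 / δ) * ((δ - |W N x| / 2) ^ 2 + 3 / 4 * W N x ^ 2) := by positivity
      have e : (1 / δ) * ((δ - |W N x| / 2) ^ 2 + 3 / 4 * W N x ^ 2) =
          δ + 1 / δ * W N x ^ 2 - |W N x| := by
        rw [sub_sq, div_pow, sq_abs]; field_simp; ring
      linarith
    simp only []
    nlinarith [mul_le_mul_of_nonneg_left h1 (hu N x)]
  rw [integral_add (j0.const_mul _) (j2.const_mul _), integral_const_mul,
      integral_const_mul] at this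
  calc _ ≤ c N * _ := mul_le_mul_of_nonneg_left this (hc N)
      _ = _ := by ring

end Sequences

/-- Young's inequality in the form used for the estimation errors. -/
lemma sq_mul_rpow_le {a d r lam : ℝ} {k : ℕ} (ha : 0 ≤ a) (hd : 0 ≤ d) (hr : 2 < r)
    (hlam : 0 < lam) :
    a ^ 2 * d ^ (2 * k * (r - 2) / r) ≤ lam * a ^ r + lam ^ (-(2 / (r - 2))) * d ^ (2 * k) := by
  have hr0 : 0 < r := by linarith
  have hr2 : 0 < r - 2 := by linarith
  -- The exponent of `lam` in the second term is such that `lam` cancels from the geometric mean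
  -- with weights 2/r and (r-2)/r.
  have h := Real.geom_mean_le_arith_mean2_weighted (w₁ := 2 / r) (w₂ := (r - 2) / r)
    (p₁ := lam * a ^ r) (p₂ := lam ^ (-(2 / (r - 2))) * d ^ (2 * k)) (by positivity)
    (by positivity) (by positivity) (by positivity) (by field_simp; ring)
  have e1 : (lam * a ^ r) ^ (2 / r) = lam ^ (2 / r) * a ^ 2 := by
    rw [Real.mul_rpow hlam.le (by positivity), ← Real.rpow_mul ha, mul_div_cancel₀ _ hr0.ne']
    norm_num
  have e2 : (lam ^ (-(2 / (r - 2))) * d ^ (2 * k)) ^ ((r - 2) / r) =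
      lam ^ (-(2 / r)) * d ^ (2 * k * (r - 2) / r) := by
    rw [Real.mul_rpow (by positivity) (by positivity), ← Real.rpow_mul hlam.le,
      ← Real.rpow_natCast d, ← Real.rpow_mul hd]
    congr 2
    · field_simp
    · push_cast; ring
  have e3 : lam ^ (2 / r) * a ^ 2 * (lam ^ (-(2 / r)) * d ^ (2 * k * (r - 2) / r)) =
      a ^ 2 * d ^ (2 * k * (r - 2) / r) := by
    have : lam ^ (2 / r) * lam ^ (-(2 / r)) = 1 := by
      rw [← Real.rpow_add hlam]; simp
    calc _ = (lam ^ (2 / r) * lam ^ (-(2 / r))) * (a ^ 2 * d ^ (2 * k * (r - 2) / r)) := by ring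
      _ = _ := by rw [this, one_mul]
  rw [e1, e2, e3] at h
  refine h.trans ?_
  have w1 : 2 / r ≤ 1 := by rw [div_le_one hr0]; exact hr.le
  have w2 : (r - 2) / r ≤ 1 := by rw [div_le_one hr0]; linarith
  exact add_le_add (mul_le_of_le_one_left (by positivity) w1)
    (mul_le_of_le_one_left (by positivity) w2)

variable {X : Type*}

section Pointwise

variable {N : ℕ} {ω f : X → ℝ} {x : Fin N → X}

lemma sum_weight_pos (hN : 1 ≤ N) (hx : ∀ n, 0 < ω (x n)) : 0 < ∑ n, ω (x n) :=
  Finset.sum_pos (fun n _ => hx n) ⟨⟨0, hN⟩, Finset.mem_univ _⟩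

lemma zHat_pos (hN : 1 ≤ N) (hx : ∀ n, 0 < ω (x n)) : 0 < zHat ω x :=
  mul_pos (by positivity) (sum_weight_pos hN hx)

lemma zHat_sub_one (hN : 1 ≤ N) : zHat ω x - 1 = (N : ℝ)⁻¹ * ∑ n, (ω (x n) - 1) := by
  have : (N : ℝ) ≠ 0 := by positivity
  simp only [zHat, Finset.sum_sub_distrib, Finset.sum_const, Finset.card_univ, Fintype.card_fin]
  field_simp
  simp

lemma fHat_sub_const (hN : 1 ≤ N) (hx : ∀ n, 0 < ω (x n)) (c : ℝ) :
    fHat ω f x - c = (∑ n, ω (x n) * (f (x n) - c)) / ∑ n, ω (x n) := by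
  have := (sum_weight_pos hN hx).ne'
  rw [fHat, eq_div_iff this, sub_mul, div_mul_cancel₀ _ this]
  simp only [mul_sub, Finset.sum_sub_distrib, ← Finset.sum_mul]
  ring

lemma fHat_sub_mul_zHat (hN : 1 ≤ N) (hx : ∀ n, 0 < ω (x n)) (c : ℝ) :
    (fHat ω f x - c) * zHat ω x = (N : ℝ)⁻¹ * ∑ n, ω (x n) * (f (x n) - c) := by
  have := (sum_weight_pos hN hx).ne'
  rw [fHat_sub_const hN hx, zHat]
  field_simp

/-- F̂ - c is an average of the f(xₙ) - c with weights ω(xₙ)/∑ω. Convexity applies, and each weight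
is then bounded by 1. No lower bound on Z enters; the price is a factor N after integration. -/
lemma abs_fHat_sub_rpow_le (hN : 1 ≤ N) (hx : ∀ n, 0 < ω (x n)) (c : ℝ) {r : ℝ} (hr : 1 ≤ r) :
    |fHat ω f x - c| ^ r ≤ ∑ n, |f (x n) - c| ^ r := by
  have hS := sum_weight_pos hN hx
  have h1 : |fHat ω f x - c| ≤ ∑ n, (ω (x n) / ∑ m, ω (x m)) * |f (x n) - c| := by
    rw [fHat_sub_const hN hx, Finset.sum_div]
    refine (Finset.abs_sum_le_sum_abs _ _).trans (Finset.sum_le_sum fun n _ => ?_)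
    rw [abs_div, abs_mul, abs_of_pos hS, abs_of_pos (hx n)]
    exact (div_mul_eq_mul_div _ _ _).ge
  have hw : ∀ n ∈ Finset.univ, 0 ≤ ω (x n) / ∑ m, ω (x m) := fun n _ => by
    have := hx n; positivity
  calc _ ≤ (∑ n, (ω (x n) / ∑ m, ω (x m)) * |f (x n) - c|) ^ r :=
        Real.rpow_le_rpow (abs_nonneg _) h1 (by linarith)
    _ ≤ ∑ n, (ω (x n) / ∑ m, ω (x m)) * |f (x n) - c| ^ r :=
        Real.rpow_arith_mean_le_arith_mean_rpow _ _ _ hw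
          (by rw [← Finset.sum_div, div_self hS.ne']) (fun _ _ => abs_nonneg _) hr
    _ ≤ _ := by
        refine Finset.sum_le_sum fun n _ => mul_le_of_le_one_left (by positivity) ?_
        rw [div_le_one hS]
        exact Finset.single_le_sum (f := fun n => ω (x n)) (fun m _ => (hx m).le)
          (Finset.mem_univ n)

/-- The squared product of the estimation error and of the error on the average weight. -/
lemma sq_mul_sq_le (hN : 1 ≤ N) (hx : ∀ n, 0 < ω (x n)) (c : ℝ) {s δ : ℝ} (hs : 2 ≤ s)
    (hδ : 0 < δ) (hδ' : δ ≤ 1 / 2) :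
    (fHat ω f x - c) ^ 2 * (zHat ω x - 1) ^ 2 ≤
      δ * (2 * ((N : ℝ)⁻¹ * ∑ n, ω (x n) * (f (x n) - c)) ^ 2) +
      δ ^ (2 - s) * ((fHat ω f x - c) ^ 2 * |zHat ω x - 1| ^ s) := by
  rw [← fHat_sub_mul_zHat hN hx]
  set h := fHat ω f x - c
  set Z := zHat ω x
  -- For |Z - 1| ≤ δ ≤ 1/2 one has Z ≥ 1/2, so h² ≤ 4(hZ)². Otherwise a higher power of |Z - 1| is
  -- bought at the cost of δ^(2-s).
  rcases le_or_gt |Z - 1| δ with hd | hd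
  · have h1 : (Z - 1) ^ 2 ≤ δ ^ 2 := sq_le_sq' (by linarith [(abs_le.1 hd).1]) (abs_le.1 hd).2
    have h2 : 1 / 2 ≤ Z := by linarith [(abs_le.1 hd).1]
    have h3 : h ^ 2 ≤ 4 * (h * Z) ^ 2 := by
      nlinarith [mul_le_mul_of_nonneg_left (show 1 ≤ 4 * Z ^ 2 by nlinarith) (sq_nonneg h)]
    have h4 : 0 ≤ δ ^ (2 - s) * (h ^ 2 * |Z - 1| ^ s) := by positivity
    have h5 : (Z - 1) ^ 2 ≤ δ / 2 := by nlinarith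
    nlinarith [mul_le_mul h3 h5 (sq_nonneg _) (by positivity)]
  · have h0 : 0 < |Z - 1| := hδ.trans hd
    have h1 : (Z - 1) ^ 2 ≤ δ ^ (2 - s) * |Z - 1| ^ s := by
      rw [← sq_abs, ← Real.rpow_two, show (2 : ℝ) = (2 - s) + s by ring, Real.rpow_add h0,
        show 2 - s + s - s = 2 - s by ring]
      exact mul_le_mul_of_nonneg_right
        (Real.rpow_le_rpow_of_nonpos hδ hd.le (by linarith)) (by positivity)
    have h2 : 0 ≤ δ * (2 * (h * Z) ^ 2) := by positivity
    nlinarith [mul_le_mul_of_nonneg_left h1 (sq_nonneg h)]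

end Pointwise

end UIS

/-! ### Moments and asymptotics of the importance sampling error. -/

namespace UIS

open ProbabilityTheory

variable {X : Type*} [MeasurableSpace X]

@[fun_prop]
lemma measurable_zHat {ω : X → ℝ} (hω : Measurable ω) (N : ℕ) :
    Measurable (zHat ω : (Fin N → X) → ℝ) := by
  unfold zHat; fun_prop

@[fun_prop]
lemma measurable_fHat {ω f : X → ℝ} (hω : Measurable ω) (hf : Measurable f) (N : ℕ) :
    Measurable (fHat ω f : (Fin N → X) → ℝ) := by
  unfold fHat; fun_prop

/-- The conditions on the weight `ω`, the test function `f` and its target value `c` under which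
the estimation errors are controlled. -/
structure MomentConditions (q : Measure X) (ω f : X → ℝ) (c r : ℝ) (k : ℕ) : Prop where
  meas_ω : Measurable ω
  meas_f : Measurable f
  pos : ∀ᵐ x ∂q, 0 < ω x
  centred_ω : ∫ x, (ω x - 1) ∂q = 0
  memLp_ω : MemLp (fun x => ω x - 1) ((2 * k : ℕ) : ℝ≥0∞) q
  memLp_ωf : MemLp (fun x => ω x * (f x - c)) 2 q
  centred_f : ∫ x, ω x * (f x - c) ∂q = 0
  integrable_f : Integrable (fun x => |f x - c| ^ r) q
  two_le : 2 ≤ k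
  two_lt : 2 < r
  gap : r + 2 < k * (r - 2)

namespace MomentConditions

variable {q : Measure X} [IsProbabilityMeasure q] {ω f : X → ℝ} {c r : ℝ} {k : ℕ}
  (H : MomentConditions q ω f c r k) {N : ℕ}

include H

lemma ae_pos (N : ℕ) : ∀ᵐ x ∂(qBar q N), ∀ n, 0 < ω (x n) :=
  ae_all_iff.2 fun n => (measurePreserving_eval_qBar q n).quasiMeasurePreserving.ae H.pos

lemma integrable_sum_rpow (N : ℕ) :
    Integrable (fun x : Fin N → X => ∑ n, |f (x n) - c| ^ r) (qBar q N) :=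
  integrable_finsetSum _ fun n _ =>
    (measurePreserving_eval_qBar q n).integrable_comp_of_integrable H.integrable_f

lemma integrable_err_rpow (hN : 1 ≤ N) :
    Integrable (fun x : Fin N → X => |fHat ω f x - c| ^ r) (qBar q N) := by
  have m1 := measurable_fHat H.meas_ω H.meas_f N
  refine (H.integrable_sum_rpow N).mono'
    ((m1.sub_const c).abs.pow_const r).aestronglyMeasurable ?_
  filter_upwards [H.ae_pos N] with x hx
  rw [Real.norm_of_nonneg (by positivity)]
  exact abs_fHat_sub_rpow_le hN hx c (by linarith [H.two_lt])

lemma integral_err_rpow_le (hN : 1 ≤ N) :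
    ∫ x : Fin N → X, |fHat ω f x - c| ^ r ∂(qBar q N) ≤ N * ∫ x, |f x - c| ^ r ∂q := by
  have mf := H.meas_f
  calc _ ≤ ∫ x : Fin N → X, ∑ n, |f (x n) - c| ^ r ∂(qBar q N) := by
        refine integral_mono_ae (H.integrable_err_rpow hN) (H.integrable_sum_rpow N) ?_
        filter_upwards [H.ae_pos N] with x hx
        exact abs_fHat_sub_rpow_le hN hx c (by linarith [H.two_lt])
    _ = _ := by
        have i1 : ∀ n : Fin N, Integrable (fun x : Fin N → X => |f (x n) - c| ^ r) (qBar q N) :=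
          fun n => (measurePreserving_eval_qBar q n).integrable_comp_of_integrable H.integrable_f
        rw [integral_finsetSum _ fun n _ => i1 n,
          Finset.sum_congr rfl fun n _ =>
          integral_eval_qBar (φ := fun x => |f x - c| ^ r) ((mf.sub_const c).abs.pow_const r) n]
        simp

lemma memLp_zHat (hN : 1 ≤ N) :
    MemLp (fun x : Fin N → X => zHat ω x - 1) ((2 * k : ℕ) : ℝ≥0∞) (qBar q N) := by
  simp only [zHat_sub_one hN]
  exact (memLp_finsetSum _ fun n _ =>
    H.memLp_ω.comp_measurePreserving (measurePreserving_eval_qBar q n)).const_mul _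

lemma integrable_zHat_pow (hN : 1 ≤ N) {m : ℕ} (hm : m ≤ 2 * k) :
    Integrable (fun x : Fin N → X => (zHat ω x - 1) ^ m) (qBar q N) :=
  memLp_integrable_pow (H.memLp_zHat hN) hm

lemma exists_zHat_moment_bound {j : ℕ} (hj : j ≤ k) :
    ∃ C : ℝ, 0 ≤ C ∧ ∀ N : ℕ, 1 ≤ N →
      ∫ x : Fin N → X, (zHat ω x - 1) ^ (2 * j) ∂(qBar q N) ≤ C * ((N : ℝ) ^ j)⁻¹ := by
  obtain ⟨C, hC, hb⟩ := exists_moment_bound (H.meas_ω.sub_const 1) j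
    (H.memLp_ω.mono_exponent (by exact_mod_cast (by omega))) H.centred_ω
  refine ⟨C, hC, fun N hN => ?_⟩
  have hN' : (N : ℝ) ≠ 0 := by positivity
  simp only [zHat_sub_one hN, mul_pow, integral_const_mul]
  calc _ ≤ ((N : ℝ)⁻¹) ^ (2 * j) * (C * (N : ℝ) ^ j) := by
        refine mul_le_mul_of_nonneg_left ?_ (by positivity)
        simpa using hb N Finset.univ
    _ = _ := by
        rw [two_mul, pow_add, inv_pow]
        field_simp

lemma tendsto_zHat_moment {j : ℕ} (hj : j ≤ k) (hj0 : j ≠ 0) :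
    Tendsto (fun N : ℕ => ∫ x : Fin N → X, (zHat ω x - 1) ^ (2 * j) ∂(qBar q N))
      atTop (𝓝 0) := by
  obtain ⟨C, hC, hb⟩ := H.exists_zHat_moment_bound hj
  have h1 : Tendsto (fun N : ℕ => C * ((N : ℝ) ^ j)⁻¹) atTop (𝓝 (C * 0)) :=
    (((tendsto_pow_atTop hj0).comp tendsto_natCast_atTop_atTop).inv_tendsto_atTop).const_mul C
  rw [mul_zero] at h1
  refine squeeze_zero' (Eventually.of_forall fun N => integral_nonneg fun x =>
    (even_two_mul j).pow_nonneg _) ?_ h1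
  filter_upwards [eventually_ge_atTop 1] with N hN using hb N hN

/-- The exponent of the weight error balanced against the square of the estimation error. -/
lemma two_le_exponent : 2 ≤ 2 * k * (r - 2) / r := by
  have := H.two_lt
  have := H.gap
  rw [le_div_iff₀ (by linarith)]
  nlinarith

lemma sq_mul_rpow_le_add {lam : ℝ} (hlam : 0 < lam) (x : Fin N → X) :
    (fHat ω f x - c) ^ 2 * |zHat ω x - 1| ^ (2 * k * (r - 2) / r) ≤
      lam * |fHat ω f x - c| ^ r + lam ^ (-(2 / (r - 2))) * (zHat ω x - 1) ^ (2 * k) := by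
  have := sq_mul_rpow_le (k := k) (abs_nonneg (fHat ω f x - c)) (abs_nonneg (zHat ω x - 1))
    H.two_lt hlam
  rwa [sq_abs, (even_two_mul k).pow_abs] at this

lemma integrable_err_sq_mul_rpow (hN : 1 ≤ N) :
    Integrable (fun x : Fin N → X =>
      (fHat ω f x - c) ^ 2 * |zHat ω x - 1| ^ (2 * k * (r - 2) / r)) (qBar q N) := by
  have m1 := measurable_fHat H.meas_ω H.meas_f N
  have m2 := measurable_zHat H.meas_ω N
  refine ((H.integrable_err_rpow hN).add (H.integrable_zHat_pow hN le_rfl)).mono'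
    (by fun_prop) (Eventually.of_forall fun x => ?_)
  rw [Real.norm_of_nonneg (by positivity)]
  simpa using H.sq_mul_rpow_le_add one_pos x

/-- With s = 2k(r-2)/r ≥ 2, the integrand is dominated by 1 + |h|^r + h²|Z - 1|^s. -/
lemma integrable_err_sq_mul_abs_pow (hN : 1 ≤ N) {m : ℕ} (hm : m ≤ 2) :
    Integrable (fun x : Fin N → X =>
      (fHat ω f x - c) ^ 2 * |zHat ω x - 1| ^ m) (qBar q N) := by
  have m1 := measurable_fHat H.meas_ω H.meas_f N
  have m2 := measurable_zHat H.meas_ω N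
  refine (((integrable_const (1 : ℝ)).add (H.integrable_err_rpow hN)).add
    (H.integrable_err_sq_mul_rpow hN)).mono' (by fun_prop) (Eventually.of_forall fun x => ?_)
  rw [Real.norm_of_nonneg (by positivity)]
  simp only [Pi.add_apply]
  set h := fHat ω f x - c
  set d := |zHat ω x - 1|
  have hr := H.two_lt
  have hs := H.two_le_exponent
  set s := 2 * k * (r - 2) / r
  have key : ∀ {a t : ℝ} {m : ℕ}, 0 ≤ a → m ≤ 2 → 2 ≤ t → a ^ m ≤ 1 + a ^ t := by
    intro a t m ha hm ht
    rcases le_total a 1 with h1 | h1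
    · have := pow_le_one₀ (n := m) ha h1
      have : 0 ≤ a ^ t := by positivity
      linarith
    · have : a ^ (m : ℝ) ≤ a ^ t := Real.rpow_le_rpow_of_exponent_le h1
        (le_trans (by exact_mod_cast hm) ht)
      rw [Real.rpow_natCast] at this
      linarith
  have h1 : h ^ 2 ≤ 1 + |h| ^ r := by
    rw [← sq_abs]; exact key (abs_nonneg h) le_rfl hr.le
  have h2 : d ^ m ≤ 1 + d ^ s := key (abs_nonneg _) hm hs
  calc h ^ 2 * d ^ m ≤ h ^ 2 * (1 + d ^ s) := by gcongr
    _ = h ^ 2 + h ^ 2 * d ^ s := by ring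
    _ ≤ _ := by gcongr

lemma integrable_err_sq (hN : 1 ≤ N) :
    Integrable (fun x : Fin N → X => (fHat ω f x - c) ^ 2) (qBar q N) := by
  simpa using H.integrable_err_sq_mul_abs_pow hN (m := 0) (by norm_num)

lemma integrable_err_sq_mul_abs (hN : 1 ≤ N) :
    Integrable (fun x : Fin N → X => (fHat ω f x - c) ^ 2 * |zHat ω x - 1|) (qBar q N) := by
  simpa using H.integrable_err_sq_mul_abs_pow hN (m := 1) (by norm_num)

lemma integrable_err_sq_mul_sq (hN : 1 ≤ N) :
    Integrable (fun x : Fin N → X => (fHat ω f x - c) ^ 2 * (zHat ω x - 1) ^ 2) (qBar q N) := by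
  simpa using H.integrable_err_sq_mul_abs_pow hN (m := 2) le_rfl

/-- Young's inequality with a parameter depending on N balances the growth E|h|^r = O(N) against the
decay E[(Z - 1)^(2k)] = O(N^(-k)). -/
lemma tendsto_mul_integral_err_sq_mul_rpow :
    Tendsto (fun N : ℕ => (N : ℝ) * ∫ x : Fin N → X,
      (fHat ω f x - c) ^ 2 * |zHat ω x - 1| ^ (2 * k * (r - 2) / r) ∂(qBar q N))
      atTop (𝓝 0) := by
  obtain ⟨C, hC, hb⟩ := H.exists_zHat_moment_bound le_rfl
  have hr := H.two_lt
  have hr2 : 0 < r - 2 := by linarith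
  set A := ∫ x, |f x - c| ^ r ∂q
  -- A quarter of the slack in `gap`. With `lam` = N^(-2-e), the two terms of Young's inequality,
  -- multiplied by N, are of orders N^(-e) and N^(-2e/(r-2)).
  set e : ℝ := (k * (r - 2) - (r + 2)) / 4 with he
  have he0 : 0 < e := div_pos (by linarith [H.gap]) (by norm_num)
  have hlim : Tendsto (fun N : ℕ => A * (N : ℝ) ^ (-e) + C * (N : ℝ) ^ (-(2 * e / (r - 2))))
      atTop (𝓝 (A * 0 + C * 0)) :=
    (((tendsto_rpow_neg_atTop he0).comp tendsto_natCast_atTop_atTop).const_mul A).add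
      (((tendsto_rpow_neg_atTop (by positivity)).comp tendsto_natCast_atTop_atTop).const_mul C)
  rw [mul_zero, mul_zero, add_zero] at hlim
  refine squeeze_zero' (Eventually.of_forall fun N => mul_nonneg (Nat.cast_nonneg _)
    (integral_nonneg fun x => by positivity)) ?_ hlim
  filter_upwards [eventually_ge_atTop 1] with N hN
  have hN0 : (0 : ℝ) < N := by positivity
  set lam : ℝ := (N : ℝ) ^ (-2 - e)
  have hlam : 0 < lam := by positivity
  have i1 := H.integrable_err_rpow hN
  have i2 := H.integrable_zHat_pow hN le_rfl
  calc _ ≤ (N : ℝ) * (lam * (N * A) + lam ^ (-(2 / (r - 2))) * (C * ((N : ℝ) ^ k)⁻¹)) := by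
        refine mul_le_mul_of_nonneg_left ?_ hN0.le
        refine (integral_mono (H.integrable_err_sq_mul_rpow hN)
          ((i1.const_mul lam).add (i2.const_mul _)) fun x => H.sq_mul_rpow_le_add hlam x).trans ?_
        simp only [Pi.add_apply]
        rw [integral_add (i1.const_mul lam) (i2.const_mul _), integral_const_mul,
          integral_const_mul]
        gcongr
        · exact H.integral_err_rpow_le hN
        · exact hb N hN
    _ = A * ((N : ℝ) * (lam * N)) + C * ((N : ℝ) * (lam ^ (-(2 / (r - 2))) * ((N : ℝ) ^ k)⁻¹)) := by
        ring
    _ = _ := by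
        congr 2
        · calc (N : ℝ) * (lam * N) = lam * (N : ℝ) ^ (2 : ℝ) := by rw [Real.rpow_two]; ring
            _ = _ := by
              rw [← Real.rpow_add hN0]
              congr 1
              ring
        · nth_rewrite 1 [← Real.rpow_one (N : ℝ)]
          rw [← Real.rpow_mul hN0.le, ← Real.rpow_natCast, ← Real.rpow_neg hN0.le,
            ← Real.rpow_add hN0, ← Real.rpow_add hN0]
          congr 1
          rw [he]
          field_simp
          ring

lemma mul_integral_mean_sq (hN : 1 ≤ N) :
    N * ∫ x, ((N : ℝ)⁻¹ * ∑ n, ω (x n) * (f (x n) - c)) ^ 2 ∂(qBar q N) =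
      ∫ x, (ω x * (f x - c)) ^ 2 ∂q := by
  have m1 := H.meas_ω
  have m2 := H.meas_f
  exact mul_integral_sq_mean (by fun_prop) H.memLp_ωf H.centred_f hN

lemma memLp_mean (N : ℕ) : MemLp (fun x : Fin N → X =>
    (N : ℝ)⁻¹ * ∑ n, ω (x n) * (f (x n) - c)) 2 (qBar q N) :=
  (memLp_finsetSum _ fun n _ =>
    H.memLp_ωf.comp_measurePreserving (measurePreserving_eval_qBar q n)).const_mul _

/-- By `sq_mul_sq_le`, the part with Z near 1 contributes δ times 2N·E[A²], which is constant in N,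
and the rest is δ^(2-s) times a vanishing quantity. -/
lemma tendsto_mul_integral_err_sq_mul_sq :
    Tendsto (fun N : ℕ => (N : ℝ) * ∫ x : Fin N → X,
      (fHat ω f x - c) ^ 2 * (zHat ω x - 1) ^ 2 ∂(qBar q N)) atTop (𝓝 0) := by
  set s := 2 * k * (r - 2) / r
  refine tendsto_zero_of_forall_delta (fun δ => δ ^ (2 - s)) (Eventually.of_forall fun N =>
    mul_nonneg (Nat.cast_nonneg _) (integral_nonneg fun x => by positivity))
    (tendsto_const_nhds (x := 2 * ∫ x, (ω x * (f x - c)) ^ 2 ∂q))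
    H.tendsto_mul_integral_err_sq_mul_rpow fun δ hδ hδ' => ?_
  filter_upwards [eventually_ge_atTop 1] with N hN
  have i1 := ((H.memLp_mean N).integrable_sq.const_mul 2).const_mul δ
  have i2 := (H.integrable_err_sq_mul_rpow hN).const_mul (δ ^ (2 - s))
  rw [← H.mul_integral_mean_sq hN]
  refine (mul_le_mul_of_nonneg_left (integral_mono_ae (H.integrable_err_sq_mul_sq hN) (i1.add i2)
    ?_) (Nat.cast_nonneg N)).trans_eq ?_
  · filter_upwards [H.ae_pos N] with x hx
    exact sq_mul_sq_le hN hx c H.two_le_exponent hδ hδ'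
  · simp only [Pi.add_apply]
    rw [integral_add i1 i2, integral_const_mul, integral_const_mul, integral_const_mul]
    ring

lemma memLp_err (hN : 1 ≤ N) : MemLp (fun x : Fin N → X => fHat ω f x - c) 2 (qBar q N) :=
  (memLp_two_iff_integrable_sq
    ((measurable_fHat H.meas_ω H.meas_f N).sub_const c).aestronglyMeasurable).2
    (H.integrable_err_sq hN)

/-- The asymptotic mean squared error of self-normalized importance sampling. -/
lemma tendsto_mul_integral_err_sq :
    Tendsto (fun N : ℕ => (N : ℝ) * ∫ x : Fin N → X, (fHat ω f x - c) ^ 2 ∂(qBar q N)) atTop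
      (𝓝 (∫ x, (ω x * (f x - c)) ^ 2 ∂q)) := by
  have key := tendsto_mul_integral_add_sq (μ := fun N => qBar q N) (c := fun N => (N : ℝ))
    (fun N => Nat.cast_nonneg N)
    (A := fun N x => (N : ℝ)⁻¹ * ∑ n, ω (x n) * (f (x n) - c))
    (E := fun N x => -((fHat ω f x - c) * (zHat ω x - 1)))
    (L := ∫ x, (ω x * (f x - c)) ^ 2 ∂q)
    (Eventually.of_forall H.memLp_mean) ?_ ?_ ?_
  · refine key.congr' ?_
    filter_upwards [eventually_ge_atTop 1] with N hN
    congr 1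
    refine integral_congr_ae ?_
    filter_upwards [H.ae_pos N] with x hx
    rw [← fHat_sub_mul_zHat hN hx]
    ring
  · filter_upwards [eventually_ge_atTop 1] with N hN
    have m1 := measurable_fHat H.meas_ω H.meas_f N
    have m2 := measurable_zHat H.meas_ω N
    refine (memLp_two_iff_integrable_sq (by fun_prop)).2 ?_
    simpa only [neg_sq, mul_pow] using H.integrable_err_sq_mul_sq hN
  · refine tendsto_const_nhds.congr' ?_
    filter_upwards [eventually_ge_atTop 1] with N hN using (H.mul_integral_mean_sq hN).symm
  · simpa only [neg_sq, mul_pow] using H.tendsto_mul_integral_err_sq_mul_sq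

lemma tendsto_mul_integral_err_sq_mul_abs :
    Tendsto (fun N : ℕ => (N : ℝ) * ∫ x : Fin N → X,
      (fHat ω f x - c) ^ 2 * |zHat ω x - 1| ∂(qBar q N)) atTop (𝓝 0) :=
  tendsto_mul_integral_mul_abs (μ := fun N => qBar q N) (c := fun N => (N : ℝ))
    (u := fun N x => (fHat ω f x - c) ^ 2) (W := fun N x => zHat ω x - 1)
    (fun N => Nat.cast_nonneg N) (fun _ _ => sq_nonneg _)
    ((eventually_ge_atTop 1).mono fun _ => H.integrable_err_sq)
    ((eventually_ge_atTop 1).mono fun _ => H.integrable_err_sq_mul_abs)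
    ((eventually_ge_atTop 1).mono fun _ => H.integrable_err_sq_mul_sq)
    H.tendsto_mul_integral_err_sq H.tendsto_mul_integral_err_sq_mul_sq

lemma integrable_abs_zHat (hN : 1 ≤ N) :
    Integrable (fun x : Fin N → X => |zHat ω x - 1|) (qBar q N) := by
  have := (H.integrable_zHat_pow hN (m := 1) (by linarith [H.two_le])).abs
  simpa using this

lemma tendsto_integral_abs_zHat :
    Tendsto (fun N : ℕ => ∫ x : Fin N → X, |zHat ω x - 1| ∂(qBar q N)) atTop (𝓝 0) := by
  have h2 := H.two_le
  have := tendsto_mul_integral_mul_abs (μ := fun N => qBar q N) (c := fun _ => 1)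
    (u := fun _ _ => 1) (W := fun N (x : Fin N → X) => zHat ω x - 1) (L := 1)
    (fun _ => zero_le_one) (fun _ _ => zero_le_one)
    (Eventually.of_forall fun _ => integrable_const _)
    ((eventually_ge_atTop 1).mono fun _ hN => by simpa using H.integrable_abs_zHat hN)
    ((eventually_ge_atTop 1).mono fun _ hN => by
      simpa using H.integrable_zHat_pow hN (m := 2) (by omega))
    (by simp)
    (by simpa using H.tendsto_zHat_moment (j := 1) (by omega) one_ne_zero)
  simpa using this

end MomentConditions

end UIS

/-! ### Paths of the coupled chains up to their meeting. -/

namespace UIS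

open ProbabilityTheory

section Paths

variable {X : Type*} {N : ℕ} {ω f : X → ℝ}

/-- The pairs (proposal, uniform) rejected from the state `x`. -/
def rejSet (ω : X → ℝ) (x : Fin N → X) : Set ((Fin N → X) × unitInterval) :=
  {e | zHat ω e.1 / zHat ω x ≤ (e.2 : ℝ)}

lemma zHat_le_of_mem_rejSet {x : Fin N → X} (hx : 0 < zHat ω x)
    {e : (Fin N → X) × unitInterval} (he : e ∈ rejSet ω x) : zHat ω e.1 ≤ zHat ω x := by
  have : zHat ω e.1 / zHat ω x ≤ 1 := le_trans he e.2.2.2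
  rwa [div_le_one hx] at this

lemma pimhStep_of_mem {x : Fin N → X} {e : (Fin N → X) × unitInterval} (he : e ∈ rejSet ω x) :
    pimhStep ω x e.1 e.2 = x :=
  if_neg (not_lt.2 he)

lemma pimhStep_of_notMem {x : Fin N → X} {e : (Fin N → X) × unitInterval}
    (he : e ∉ rejSet ω x) : pimhStep ω x e.1 e.2 = e.1 :=
  if_pos (not_le.1 he)

variable {z : Draws X N}

/-- As long as the first chain rejects, it stays at its initial state, and the second chain is at
one of the rejected proposals. -/
lemma laggedPair_of_forall_mem (h0 : 0 < zHat ω z.1) {t : ℕ}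
    (h : ∀ i ≤ t, z.2 i ∈ rejSet ω z.1) :
    (laggedPair ω z t).1 = z.1 ∧ zHat ω (laggedPair ω z t).2 ≤ zHat ω z.1 ∧
      ∃ j ≤ t, (laggedPair ω z t).2 = (z.2 j).1 := by
  induction t with
  | zero =>
    exact ⟨pimhStep_of_mem (h 0 le_rfl), zHat_le_of_mem_rejSet h0 (h 0 le_rfl), 0, le_rfl, rfl⟩
  | succ t ih =>
    obtain ⟨h1, h2, j, hj, h3⟩ := ih fun i hi => h i (hi.trans t.le_succ)
    have ht := h (t + 1) le_rfl
    refine ⟨?_, ?_⟩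
    · change pimhStep ω (laggedPair ω z t).1 _ _ = _
      rw [h1]
      exact pimhStep_of_mem ht
    · change zHat ω (pimhStep ω (laggedPair ω z t).2 _ _) ≤ _ ∧
        ∃ j ≤ t + 1, pimhStep ω (laggedPair ω z t).2 _ _ = _
      by_cases hy : z.2 (t + 1) ∈ rejSet ω (laggedPair ω z t).2
      · rw [pimhStep_of_mem hy]
        exact ⟨h2, j, hj.trans t.le_succ, h3⟩
      · rw [pimhStep_of_notMem hy]
        exact ⟨zHat_le_of_mem_rejSet h0 ht, t + 1, le_rfl, rfl⟩

/-- The two chains meet when the first chain accepts for the first time. -/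
lemma laggedPair_eq_of_notMem (h0 : 0 < zHat ω z.1) (hd : ∀ i, 0 < zHat ω (z.2 i).1) {t : ℕ}
    (h : ∀ i < t, z.2 i ∈ rejSet ω z.1) (ht : z.2 t ∉ rejSet ω z.1) :
    (laggedPair ω z t).1 = (laggedPair ω z t).2 := by
  cases t with
  | zero => exact pimhStep_of_notMem ht
  | succ t =>
    obtain ⟨h1, h2, j, -, h3⟩ :=
      laggedPair_of_forall_mem h0 fun i hi => h i (Nat.lt_succ_of_le hi)
    change pimhStep ω (laggedPair ω z t).1 _ _ = pimhStep ω (laggedPair ω z t).2 _ _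
    rw [h1, pimhStep_of_notMem ht, pimhStep_of_notMem]
    intro hy
    -- The second chain has the smaller average weight, hence the larger acceptance ratio: what it
    -- rejects, the first chain rejects.
    exact ht ((div_le_div_of_nonneg_left (hd _).le (h3 ▸ hd j) h2).trans hy)

lemma laggedPair_eq_of_le {s t : ℕ} (hs : (laggedPair ω z s).1 = (laggedPair ω z s).2)
    (hst : s ≤ t) : (laggedPair ω z t).1 = (laggedPair ω z t).2 := by
  induction t, hst using Nat.le_induction with
  | base => exact hs
  | succ t _ ih =>
    change pimhStep ω (laggedPair ω z t).1 _ _ = pimhStep ω (laggedPair ω z t).2 _ _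
    rw [ih]

/-- The pair of index m is (x_{m+1}, y_m), so the first coincidence of the pair at index m is τ = m
+ 1. -/
lemma exists_meetingTime_eq {s : ℕ} (hs : (laggedPair ω z s).1 = (laggedPair ω z s).2) :
    ∃ m ≤ s, meetingTime ω z = ((m + 1 : ℕ) : ℕ∞) ∧
      (laggedPair ω z m).1 = (laggedPair ω z m).2 := by
  classical
  have hex : ∃ m, (laggedPair ω z m).1 = (laggedPair ω z m).2 := ⟨s, hs⟩
  refine ⟨Nat.find hex, Nat.find_min' hex hs, le_antisymm ?_ ?_, Nat.find_spec hex⟩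
  · exact iInf₂_le (Nat.find hex + 1) ⟨Nat.le_add_left _ _, Nat.find_spec hex⟩
  · refine le_iInf₂ fun t ⟨ht, hm⟩ => ?_
    obtain ⟨t, rfl⟩ := Nat.exists_eq_add_of_le' ht
    exact_mod_cast Nat.succ_le_succ (Nat.find_min' hex hm)

lemma meetingTime_lt_top {s : ℕ} (hs : (laggedPair ω z s).1 = (laggedPair ω z s).2) :
    meetingTime ω z < ⊤ := by
  obtain ⟨m, -, h, -⟩ := exists_meetingTime_eq hs
  rw [h]
  exact ENat.natCast_lt_top _

/-- The estimator does not depend on the time, after the meeting, at which the sum stops. -/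
lemma uis_eq {s : ℕ} (hs : (laggedPair ω z s).1 = (laggedPair ω z s).2) :
    uis ω f z = fHat ω f z.1 + ∑ t ∈ Finset.range s,
      (fHat ω f (laggedPair ω z t).1 - fHat ω f (laggedPair ω z t).2) := by
  obtain ⟨m, hm, h, he⟩ := exists_meetingTime_eq hs
  rw [uis, h, ENat.toNat_natCast, Finset.sum_Ico_eq_sum_range, Nat.add_sub_cancel]
  have : ∀ t, fHat ω f (chainX ω z (1 + t)) - fHat ω f (chainY ω z (1 + t - 1)) =
      fHat ω f (laggedPair ω z t).1 - fHat ω f (laggedPair ω z t).2 := fun t => by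
    rw [Nat.add_sub_cancel_left, Nat.add_comm]
    rfl
  simp only [this]
  congr 1
  refine Finset.sum_subset (Finset.range_subset_range.2 hm) fun t _ ht => ?_
  rw [laggedPair_eq_of_le he (by simpa using ht), sub_self]

/-- The bias correction, when the first `s` proposals are rejected and the next one is accepted. -/
lemma sq_uis_sub_le (h0 : 0 < zHat ω z.1) (hd : ∀ i, 0 < zHat ω (z.2 i).1) {s : ℕ}
    (h : ∀ i < s, z.2 i ∈ rejSet ω z.1) (hs : z.2 s ∉ rejSet ω z.1) (c : ℝ) :
    (uis ω f z - fHat ω f z.1) ^ 2 ≤ 2 * (s : ℝ) ^ 2 * (fHat ω f z.1 - c) ^ 2 +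
      2 * (s : ℝ) ^ 2 * ∑ j ∈ Finset.range s, (fHat ω f (z.2 j).1 - c) ^ 2 := by
  set S := ∑ j ∈ Finset.range s, (fHat ω f (z.2 j).1 - c) ^ 2
  have hy : ∀ t ∈ Finset.range s,
      (fHat ω f (laggedPair ω z t).1 - fHat ω f (laggedPair ω z t).2) ^ 2 ≤
        2 * (fHat ω f z.1 - c) ^ 2 + 2 * S := by
    intro t ht
    obtain ⟨h1, -, j, hj, h3⟩ := laggedPair_of_forall_mem h0
      fun i hi => h i (hi.trans_lt (Finset.mem_range.1 ht))
    have hS : (fHat ω f (z.2 j).1 - c) ^ 2 ≤ S :=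
      Finset.single_le_sum (f := fun j => (fHat ω f (z.2 j).1 - c) ^ 2)
        (fun _ _ => sq_nonneg _) (Finset.mem_range.2 (hj.trans_lt (Finset.mem_range.1 ht)))
    rw [h1, h3]
    nlinarith [sq_nonneg ((fHat ω f z.1 - c) + (fHat ω f (z.2 j).1 - c))]
  rw [uis_eq (laggedPair_eq_of_notMem h0 hd h hs), add_sub_cancel_left]
  calc _ ≤ (Finset.range s).card * ∑ t ∈ Finset.range s,
        (fHat ω f (laggedPair ω z t).1 - fHat ω f (laggedPair ω z t).2) ^ 2 :=
        sq_sum_le_card_mul_sum_sq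
    _ ≤ (Finset.range s).card * ∑ t ∈ Finset.range s, (2 * (fHat ω f z.1 - c) ^ 2 + 2 * S) := by
        gcongr with t ht
        exact hy t ht
    _ = _ := by
        simp only [Finset.sum_const, Finset.card_range, nsmul_eq_mul]
        ring

lemma sum_range_two_mul_add_one (s : ℕ) :
    ∑ t ∈ Finset.range s, (2 * (t : ℝ≥0∞) + 1) = (s : ℝ≥0∞) ^ 2 := by
  induction s with
  | zero => simp
  | succ s ih => rw [Finset.sum_range_succ, ih]; push_cast; ring

/-- The indicator that the first `t + 1` draws lie in `R`. -/
noncomputable def allIn {E : Type*} (R : Set E) (t : ℕ) (d : ℕ → E) : ℝ≥0∞ :=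
  ∏ i ∈ Finset.range (t + 1), R.indicator 1 (d i)

lemma allIn_eq_one {E : Type*} {R : Set E} {t : ℕ} {d : ℕ → E} (h : ∀ i ≤ t, d i ∈ R) :
    allIn R t d = 1 :=
  Finset.prod_eq_one fun i hi =>
    Set.indicator_of_mem (h i (Nat.lt_succ_iff.1 (Finset.mem_range.1 hi))) _

/-- The bias correction is controlled by sums over all times, with no reference to the chains. -/
lemma ofReal_sq_uis_sub_le (h0 : 0 < zHat ω z.1) (hd : ∀ i, 0 < zHat ω (z.2 i).1)
    (hex : ∃ s, z.2 s ∉ rejSet ω z.1) (c : ℝ) :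
    ENNReal.ofReal ((uis ω f z - fHat ω f z.1) ^ 2) ≤
      2 * ENNReal.ofReal ((fHat ω f z.1 - c) ^ 2) *
        (∑' t : ℕ, (2 * (t : ℝ≥0∞) + 1) * allIn (rejSet ω z.1) t z.2) +
      2 * ∑' t : ℕ, ((t : ℝ≥0∞) + 1) ^ 2 * ∑ j ∈ Finset.range (t + 1),
        allIn (rejSet ω z.1) t z.2 * ENNReal.ofReal ((fHat ω f (z.2 j).1 - c) ^ 2) := by
  classical
  set s := Nat.find hex
  have hs : z.2 s ∉ rejSet ω z.1 := Nat.find_spec hex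
  have h : ∀ i < s, z.2 i ∈ rejSet ω z.1 := fun i hi => not_not.1 (Nat.find_min hex hi)
  refine (ENNReal.ofReal_le_ofReal (sq_uis_sub_le h0 hd h hs c)).trans ?_
  have e : ENNReal.ofReal (2 * (s : ℝ) ^ 2) = 2 * (s : ℝ≥0∞) ^ 2 := by
    rw [ENNReal.ofReal_mul zero_le_two, ENNReal.ofReal_pow (by positivity),
      ENNReal.ofReal_natCast, ENNReal.ofReal_ofNat]
  rw [ENNReal.ofReal_add (by positivity) (by positivity),
    ENNReal.ofReal_mul (p := 2 * (s : ℝ) ^ 2) (by positivity),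
    ENNReal.ofReal_mul (p := 2 * (s : ℝ) ^ 2) (by positivity), e,
    ENNReal.ofReal_sum_of_nonneg fun _ _ => sq_nonneg _]
  refine add_le_add ?_ ?_
  · rw [mul_assoc, mul_assoc, mul_comm _ (ENNReal.ofReal _)]
    gcongr
    -- The square s² is a sum of odd numbers over t < s, and each such t has its first t + 1 draws
    -- rejected; s can thus be replaced by a series of indicators.
    rw [← sum_range_two_mul_add_one]
    calc _ = ∑ t ∈ Finset.range s, (2 * (t : ℝ≥0∞) + 1) * allIn (rejSet ω z.1) t z.2 := by
          refine Finset.sum_congr rfl fun t ht => ?_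
          rw [allIn_eq_one fun i hi => h i (hi.trans_lt (Finset.mem_range.1 ht)), mul_one]
      _ ≤ _ := ENNReal.sum_le_tsum _
  · rw [mul_assoc]
    gcongr
    rcases Nat.eq_zero_or_pos s with hs0 | hs0
    · simp [hs0]
    · obtain ⟨t, ht⟩ := Nat.exists_eq_add_of_le' hs0
      -- Only the term t = s - 1 is needed: its coefficient is s² and its inner sum runs over all j
      -- < s.
      refine le_trans (le_of_eq ?_) (ENNReal.le_tsum t)
      rw [ht, allIn_eq_one fun i hi => h i (by omega)]
      simp

end Paths

/-! ### Integrals over runs of independent draws. -/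

section Product

variable {E : Type*} [MeasurableSpace E] {m : Measure E} [IsProbabilityMeasure m] {R : Set E}

lemma measurable_allIn (hR : MeasurableSet R) (t : ℕ) : Measurable (allIn R t) := by
  unfold allIn
  exact Finset.measurable_fun_prod _ fun i _ =>
    (measurable_one.indicator hR).comp (measurable_pi_apply i)

lemma lintegral_prod_infinitePi {g : ℕ → E → ℝ≥0∞} (hg : ∀ i, Measurable (g i))
    (s : Finset ℕ) :
    ∫⁻ d, ∏ i ∈ s, g i (d i) ∂(Measure.infinitePi fun _ : ℕ => m) =
      ∏ i ∈ s, ∫⁻ e, g i e ∂m := by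
  rw [lintegral_prod_eq_prod_lintegral_of_indepFun s (fun i (d : ℕ → E) => g i (d i))
    (iIndepFun_infinitePi (fun i => hg i)) fun i => (hg i).comp (measurable_pi_apply i)]
  refine Finset.prod_congr rfl fun i _ => ?_
  exact (measurePreserving_eval_infinitePi (fun _ : ℕ => m) i).lintegral_comp (hg i)

lemma lintegral_allIn (hR : MeasurableSet R) (t : ℕ) :
    ∫⁻ d, allIn R t d ∂(Measure.infinitePi fun _ : ℕ => m) = m R ^ (t + 1) := by
  unfold allIn
  rw [lintegral_prod_infinitePi (g := fun _ => R.indicator 1)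
    fun _ => measurable_one.indicator hR]
  simp [lintegral_indicator_one hR]

/-- By independence, the factor of index j integrates `g` over `R` and each of the t others
contributes `m R`. -/
lemma lintegral_allIn_mul (hR : MeasurableSet R) {g : E → ℝ≥0∞} (hg : Measurable g) {t j : ℕ}
    (hj : j ∈ Finset.range (t + 1)) :
    ∫⁻ d, allIn R t d * g (d j) ∂(Measure.infinitePi fun _ : ℕ => m) =
      m R ^ t * ∫⁻ e in R, g e ∂m := by
  have hm : ∀ i, Measurable (fun e => R.indicator 1 e * if i = j then g e else 1) := fun i => by
    split_ifs
    · exact (measurable_one.indicator hR).mul hg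
    · exact (measurable_one.indicator hR).mul measurable_const
  have e1 : ∀ d : ℕ → E, allIn R t d * g (d j) =
      ∏ i ∈ Finset.range (t + 1), (R.indicator 1 (d i) * if i = j then g (d i) else 1) := by
    intro d
    rw [Finset.prod_mul_distrib, Finset.prod_ite_eq' _ _ (fun i => g (d i)), if_pos hj]
    rfl
  simp only [e1]
  rw [lintegral_prod_infinitePi (g := fun i e => R.indicator 1 e * if i = j then g e else 1) hm,
    ← Finset.mul_prod_erase _ _ hj, mul_comm]
  congr 1
  · rw [Finset.prod_congr rfl (g := fun _ => m R)]
    · simp [Finset.card_erase_of_mem hj]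
    · intro i hi
      simp [(Finset.mem_erase.1 hi).1, lintegral_indicator_one hR]
  · rw [← lintegral_indicator hR]
    refine lintegral_congr fun e => ?_
    by_cases he : e ∈ R <;> simp [he]

end Product

end UIS

/-! ### Geometric series and bounds on the rejection probability. -/

namespace UIS

open ProbabilityTheory

lemma tsum_choose_mul_pow_le {a : ℝ} (ha : 0 < a) (ha1 : a ≤ 1) {ρ : ℝ≥0∞}
    (hρ : ρ ≤ ENNReal.ofReal (1 - a)) (k : ℕ) :
    ∑' t : ℕ, ((t + k).choose k : ℝ≥0∞) * ρ ^ t ≤ ENNReal.ofReal (1 / a ^ (k + 1)) := by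
  have h0 : 0 ≤ 1 - a := by linarith
  have hs := hasSum_choose_mul_geometric_of_norm_lt_one k
    (show ‖1 - a‖ < 1 by rw [Real.norm_of_nonneg h0]; linarith)
  rw [sub_sub_cancel] at hs
  rw [← hs.tsum_eq, ENNReal.ofReal_tsum_of_nonneg (fun n => by positivity) hs.summable]
  refine ENNReal.tsum_le_tsum fun t => ?_
  rw [ENNReal.ofReal_mul (by positivity), ENNReal.ofReal_natCast, ENNReal.ofReal_pow h0]
  gcongr

/-- One factor ρ is kept outside the series: it is the source of smallness, while `a` only has to
control the sum. -/
lemma tsum_linear_mul_pow_le {a : ℝ} (ha : 0 < a) (ha1 : a ≤ 1) {ρ : ℝ≥0∞}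
    (hρ : ρ ≤ ENNReal.ofReal (1 - a)) :
    ∑' t : ℕ, (2 * (t : ℝ≥0∞) + 1) * ρ ^ (t + 1) ≤ ρ * ENNReal.ofReal (2 / a ^ 2) := by
  calc _ ≤ ∑' t : ℕ, ρ * (2 * (((t + 1).choose 1 : ℕ) * ρ ^ t)) := by
        refine ENNReal.tsum_le_tsum fun t => ?_
        rw [Nat.choose_one_right, pow_succ]
        calc (2 * (t : ℝ≥0∞) + 1) * (ρ ^ t * ρ) ≤ (2 * (t : ℝ≥0∞) + 2) * (ρ ^ t * ρ) := by
              gcongr; exact one_le_two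
          _ = _ := by push_cast; ring
    _ = ρ * (2 * ∑' t : ℕ, ((t + 1).choose 1 : ℕ) * ρ ^ t) := by
        rw [ENNReal.tsum_mul_left, ENNReal.tsum_mul_left]
    _ ≤ ρ * (2 * ENNReal.ofReal (1 / a ^ 2)) := by
        gcongr
        exact tsum_choose_mul_pow_le ha ha1 hρ 1
    _ = _ := by
        rw [← ENNReal.ofReal_ofNat, ← ENNReal.ofReal_mul (by positivity), mul_one_div]

lemma tsum_cube_mul_pow_le {a : ℝ} (ha : 0 < a) (ha1 : a ≤ 1) {ρ : ℝ≥0∞}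
    (hρ : ρ ≤ ENNReal.ofReal (1 - a)) :
    ∑' t : ℕ, ((t : ℝ≥0∞) + 1) ^ 3 * ρ ^ t ≤ ENNReal.ofReal (6 / a ^ 4) := by
  calc _ ≤ ∑' t : ℕ, 6 * (((t + 3).choose 3 : ℕ) * ρ ^ t) := by
        refine ENNReal.tsum_le_tsum fun t => ?_
        rw [← mul_assoc]
        gcongr
        -- (t+1)³ ≤ (t+3)(t+2)(t+1), which is 6 times the binomial coefficient.
        have h1 := Nat.pow_sub_le_descFactorial (t + 3) 3
        rw [Nat.descFactorial_eq_factorial_mul_choose, show t + 3 + 1 - 3 = t + 1 by omega] at h1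
        exact_mod_cast h1
    _ = 6 * ∑' t : ℕ, ((t + 3).choose 3 : ℕ) * ρ ^ t := ENNReal.tsum_mul_left
    _ ≤ 6 * ENNReal.ofReal (1 / a ^ 4) := by
        gcongr
        exact tsum_choose_mul_pow_le ha ha1 hρ 3
    _ = _ := by
        rw [← ENNReal.ofReal_ofNat, ← ENNReal.ofReal_mul (by positivity), mul_one_div]

lemma volume_unitInterval_le (c : ℝ) (hc : 0 ≤ c) :
    volume {u : unitInterval | c ≤ (u : ℝ)} ≤ ENNReal.ofReal (1 - c) := by
  rcases le_or_gt c 1 with h | h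
  · exact (unitInterval.volume_Ici ⟨c, hc, h⟩).le
  · have : {u : unitInterval | c ≤ (u : ℝ)} = ∅ :=
      Set.eq_empty_of_forall_notMem fun u hu => absurd (hu.trans u.2.2) (not_le.2 h)
    simp [this]

section Rejection

variable {y z : ℝ}

/-- For z ≤ 1 the left side is at most 1 - y; for z ≥ 1 it is (z - y)/z ≤ z - y. It makes the
rejection probability small when both weights are near 1. -/
lemma one_sub_div_le_abs (hy : 0 < y) (hz : 0 < z) : 1 - y / z ≤ |z - 1| + |y - 1| := by
  have h1 := abs_nonneg (z - 1)
  have h2 := abs_nonneg (y - 1)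
  have h3 := neg_abs_le (y - 1)
  have h4 := le_abs_self (z - 1)
  rcases le_total z 1 with h | h
  · have : y ≤ y / z := by rw [le_div_iff₀ hz]; nlinarith
    linarith
  · rw [one_sub_div hz.ne', div_le_iff₀ hz]
    nlinarith

/-- A nonnegative quadratic majorant in y of the positive part of 1 - y/z, so that its mean needs
only the first two moments of Z. -/
lemma one_sub_div_le_sq {w : ℝ} (hy : 0 < y) (hz : 0 < z) (hw : z ≤ w) :
    1 - y / z ≤ (1 - y / (2 * w)) ^ 2 := by
  have h1 : y / w ≤ y / z := div_le_div_of_nonneg_left hy.le hz hw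
  have h2 : (1 - y / (2 * w)) ^ 2 = 1 - y / w + (y / (2 * w)) ^ 2 := by
    have : w ≠ 0 := (hz.trans_le hw).ne'
    field_simp
    ring
  nlinarith [sq_nonneg (y / (2 * w))]

end Rejection

variable {X : Type*} [MeasurableSpace X]

lemma measurableSet_rejSet {ω : X → ℝ} (hω : Measurable ω) {N : ℕ} (x : Fin N → X) :
    MeasurableSet (rejSet ω x) :=
  measurableSet_le (((measurable_zHat hω N).comp measurable_fst).div_const _)
    (measurable_subtype_coe.comp measurable_snd)

namespace MomentConditions

variable {q : Measure X} [IsProbabilityMeasure q] {ω f : X → ℝ} {c r : ℝ} {k : ℕ}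
  (H : MomentConditions q ω f c r k) {N : ℕ}

include H

lemma ae_zHat_pos (hN : 1 ≤ N) : ∀ᵐ x ∂(qBar q N), 0 < zHat ω x :=
  (H.ae_pos N).mono fun _ => zHat_pos hN

/-- Integrals over the rejected draws, after integration of the uniform variable. -/
lemma setLIntegral_rejSet_le (hN : 1 ≤ N) {x : Fin N → X} (hx : 0 < zHat ω x)
    (g : (Fin N → X) → ℝ≥0∞) :
    ∫⁻ e in rejSet ω x, g e.1 ∂((qBar q N).prod (volume : Measure unitInterval)) ≤
      ∫⁻ d, g d * ENNReal.ofReal (1 - zHat ω d / zHat ω x) ∂(qBar q N) := by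
  have hR := measurableSet_rejSet H.meas_ω x
  rw [← lintegral_indicator hR]
  -- This half of Tonelli's theorem requires no measurability of `g`.
  refine (lintegral_prod_le _).trans (lintegral_mono_ae ?_)
  filter_upwards [H.ae_zHat_pos hN] with d hd
  have hS : MeasurableSet {u : unitInterval | zHat ω d / zHat ω x ≤ (u : ℝ)} :=
    measurableSet_le measurable_const measurable_subtype_coe
  calc _ = ∫⁻ u : unitInterval,
        {u : unitInterval | zHat ω d / zHat ω x ≤ (u : ℝ)}.indicator (fun _ => g d) u := rfl
    _ = g d * volume {u : unitInterval | zHat ω d / zHat ω x ≤ (u : ℝ)} := by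
        rw [lintegral_indicator hS, setLIntegral_const]
    _ ≤ _ := by
        gcongr
        exact volume_unitInterval_le _ (by positivity)

lemma setLIntegral_rejSet_le_ofReal (hN : 1 ≤ N) {x : Fin N → X} (hx : 0 < zHat ω x)
    {g h : (Fin N → X) → ℝ} (hg0 : ∀ d, 0 ≤ g d)
    (hh : Integrable h (qBar q N)) (hh0 : ∀ d, 0 ≤ h d)
    (hle : ∀ d, 0 < zHat ω d → g d * (1 - zHat ω d / zHat ω x) ≤ h d) :
    ∫⁻ e in rejSet ω x, ENNReal.ofReal (g e.1)
        ∂((qBar q N).prod (volume : Measure unitInterval)) ≤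
      ENNReal.ofReal (∫ d, h d ∂(qBar q N)) := by
  rw [ofReal_integral_eq_lintegral_ofReal hh (Eventually.of_forall hh0)]
  refine (H.setLIntegral_rejSet_le hN hx fun d => ENNReal.ofReal (g d)).trans (lintegral_mono_ae ?_)
  filter_upwards [H.ae_zHat_pos hN] with d hd
  rw [← ENNReal.ofReal_mul (hg0 d)]
  exact ENNReal.ofReal_le_ofReal (hle d hd)

lemma measure_rejSet_le_ofReal (hN : 1 ≤ N) {x : Fin N → X} (hx : 0 < zHat ω x)
    {h : (Fin N → X) → ℝ} (hh : Integrable h (qBar q N)) (hh0 : ∀ d, 0 ≤ h d)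
    (hle : ∀ d, 0 < zHat ω d → 1 - zHat ω d / zHat ω x ≤ h d) :
    (qBar q N).prod (volume : Measure unitInterval) (rejSet ω x) ≤
      ENNReal.ofReal (∫ d, h d ∂(qBar q N)) := by
  have := H.setLIntegral_rejSet_le_ofReal hN hx (g := fun _ => 1)
    (fun _ => zero_le_one) hh hh0 (by simpa using hle)
  simpa using this

lemma measure_rejSet_le_abs (hN : 1 ≤ N) {x : Fin N → X} (hx : 0 < zHat ω x) :
    (qBar q N).prod (volume : Measure unitInterval) (rejSet ω x) ≤
      ENNReal.ofReal (|zHat ω x - 1| + ∫ d : Fin N → X, |zHat ω d - 1| ∂(qBar q N)) := by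
  have := H.measure_rejSet_le_ofReal hN hx (h := fun d => |zHat ω x - 1| + |zHat ω d - 1|)
    ((integrable_const _).add (H.integrable_abs_zHat hN)) (fun d => by positivity)
    fun d hd => one_sub_div_le_abs hd hx
  rwa [integral_add (integrable_const _) (H.integrable_abs_zHat hN), integral_const,
    probReal_univ, one_smul] at this

lemma integral_zHat_sub_one (hN : 1 ≤ N) :
    ∫ x : Fin N → X, (zHat ω x - 1) ∂(qBar q N) = 0 := by
  have m := H.meas_ω
  have i1 : Integrable (fun x => ω x - 1) q := by
    have h2 := H.two_le
    simpa using memLp_integrable_pow (m := 1) H.memLp_ω (by omega)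
  have i2 : ∀ n : Fin N, Integrable (fun x : Fin N → X => ω (x n) - 1) (qBar q N) :=
    fun n => (measurePreserving_eval_qBar q n).integrable_comp_of_integrable i1
  simp only [zHat_sub_one hN]
  rw [integral_const_mul, integral_finsetSum _ fun n _ => i2 n,
    Finset.sum_eq_zero fun n _ => by
      rw [integral_eval_qBar (φ := fun x => ω x - 1) (by fun_prop) n, H.centred_ω], mul_zero]

/-- The rejection probability stays away from one, with an explicit dependence on the state. -/
lemma measure_rejSet_le_one_sub (hN : 1 ≤ N) {x : Fin N → X} (hx : 0 < zHat ω x) {V : ℝ}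
    (hV : ∫ d : Fin N → X, (zHat ω d - 1) ^ 2 ∂(qBar q N) ≤ V) :
    (qBar q N).prod (volume : Measure unitInterval) (rejSet ω x) ≤
      ENNReal.ofReal (1 - 3 / (4 * (zHat ω x + (1 + V)))) := by
  have h2 := H.two_le
  have hV0 : 0 ≤ V := le_trans (integral_nonneg fun _ => sq_nonneg _) hV
  set w := zHat ω x + (1 + V) with hw
  have hw0 : 0 < w := by positivity
  have i1 : Integrable (fun x : Fin N → X => zHat ω x - 1) (qBar q N) := by
    simpa using H.integrable_zHat_pow hN (m := 1) (by omega)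
  have i2 : Integrable (fun x : Fin N → X => (zHat ω x - 1) ^ 2) (qBar q N) :=
    H.integrable_zHat_pow hN (by omega)
  -- Expansion around Z = 1: the linear term integrates to 0 and the quadratic one to at most
  -- V/(4w²). Then 1 + V ≤ w yields 1 - 3/(4w).
  have e : ∀ d : Fin N → X, (1 - zHat ω d / (2 * w)) ^ 2 = (1 - 1 / w + 1 / (4 * w ^ 2)) +
      ((1 / (2 * w ^ 2) - 1 / w) * (zHat ω d - 1) + 1 / (4 * w ^ 2) * (zHat ω d - 1) ^ 2) :=
    fun d => by field_simp; ring
  have i3 : Integrable (fun d : Fin N → X => (1 / (2 * w ^ 2) - 1 / w) * (zHat ω d - 1) +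
      1 / (4 * w ^ 2) * (zHat ω d - 1) ^ 2) (qBar q N) := (i1.const_mul _).add (i2.const_mul _)
  have key := H.measure_rejSet_le_ofReal hN hx (h := fun d => (1 - zHat ω d / (2 * w)) ^ 2)
    (by simp only [e]; exact (integrable_const _).add i3) (fun d => sq_nonneg _)
    fun d hd => one_sub_div_le_sq hd hx (by linarith)
  refine key.trans (ENNReal.ofReal_le_ofReal ?_)
  simp only [e]
  rw [integral_add (integrable_const _) i3, integral_add (i1.const_mul _) (i2.const_mul _),
    integral_const_mul, integral_const_mul, H.integral_zHat_sub_one hN, integral_const,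
    probReal_univ, one_smul, mul_zero, zero_add]
  calc _ ≤ 1 - 1 / w + 1 / (4 * w ^ 2) + 1 / (4 * w ^ 2) * V := by gcongr
    _ = 1 - 1 / w + (1 + V) / (4 * w ^ 2) := by ring
    _ ≤ 1 - 1 / w + w / (4 * w ^ 2) := by gcongr; linarith
    _ = _ := by field_simp; ring

lemma setLIntegral_rejSet_err_le (hN : 1 ≤ N) {x : Fin N → X} (hx : 0 < zHat ω x) :
    ∫⁻ e in rejSet ω x, ENNReal.ofReal ((fHat ω f e.1 - c) ^ 2)
        ∂((qBar q N).prod (volume : Measure unitInterval)) ≤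
      ENNReal.ofReal (∫ d : Fin N → X, (fHat ω f d - c) ^ 2 ∂(qBar q N)) := by
  refine H.setLIntegral_rejSet_le_ofReal hN hx (g := fun d => (fHat ω f d - c) ^ 2)
    (fun _ => sq_nonneg _)
    (H.integrable_err_sq hN) (fun _ => sq_nonneg _) fun d hd => ?_
  have : 0 < zHat ω d / zHat ω x := by positivity
  exact mul_le_of_le_one_right (sq_nonneg _) (by linarith)

lemma setLIntegral_rejSet_err_le_abs (hN : 1 ≤ N) {x : Fin N → X} (hx : 0 < zHat ω x) :
    ∫⁻ e in rejSet ω x, ENNReal.ofReal ((fHat ω f e.1 - c) ^ 2)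
        ∂((qBar q N).prod (volume : Measure unitInterval)) ≤
      ENNReal.ofReal (|zHat ω x - 1| * (∫ d : Fin N → X, (fHat ω f d - c) ^ 2 ∂(qBar q N)) +
        ∫ d : Fin N → X, (fHat ω f d - c) ^ 2 * |zHat ω d - 1| ∂(qBar q N)) := by
  rw [← integral_const_mul, ← integral_add ((H.integrable_err_sq hN).const_mul _)
    (H.integrable_err_sq_mul_abs hN)]
  refine H.setLIntegral_rejSet_le_ofReal hN hx (g := fun d => (fHat ω f d - c) ^ 2)
    (fun _ => sq_nonneg _)
    (((H.integrable_err_sq hN).const_mul _).add (H.integrable_err_sq_mul_abs hN))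
    (fun d => by positivity) fun d hd => ?_
  have := mul_le_mul_of_nonneg_left (one_sub_div_le_abs hd hx) (sq_nonneg (fHat ω f d - c))
  linarith

end MomentConditions

end UIS

/-! ### The bias correction given the initial state; almost sure meeting and measurability. -/

namespace UIS

open ProbabilityTheory

variable {X : Type*} [MeasurableSpace X]

/-- The law of one pair (proposal, uniform). -/
noncomputable abbrev stepLaw (q : Measure X) (N : ℕ) : Measure ((Fin N → X) × unitInterval) :=
  (qBar q N).prod volume

/-- The law of the sequence of pairs (proposal, uniform). -/
noncomputable abbrev stepsLaw (q : Measure X) [IsProbabilityMeasure q] (N : ℕ) :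
    Measure (ℕ → (Fin N → X) × unitInterval) :=
  Measure.infinitePi fun _ : ℕ => stepLaw q N

lemma measurable_laggedPair {ω : X → ℝ} (hω : Measurable ω) {N : ℕ} (t : ℕ) :
    Measurable fun z : Draws X N => laggedPair ω z t := by
  have m := measurable_zHat hω N
  have key : ∀ {a : Draws X N → Fin N → X}, Measurable a → ∀ i,
      Measurable fun z : Draws X N => pimhStep ω (a z) (z.2 i).1 (z.2 i).2 := by
    intro a ha i
    unfold pimhStep
    exact Measurable.ite (measurableSet_lt (by fun_prop) (by fun_prop)) (by fun_prop) ha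
  induction t with
  | zero =>
    have h2 : Measurable fun z : Draws X N => (z.2 0).1 := by fun_prop
    exact (key measurable_fst 0).prodMk h2
  | succ t ih => exact (key ih.fst (t + 1)).prodMk (key ih.snd (t + 1))

/-- The bound on the conditional second moment of the bias correction. -/
noncomputable def corrBound (V g0 g1 d1 h D : ℝ) : ℝ :=
  32 * (h ^ 2 * D ^ 2) + 32 * (2 + V) ^ 2 * (h ^ 2 * D + d1 * h ^ 2) +
    1536 * (g0 * D ^ 4 + (2 + V) ^ 4 * (g0 * D + g1))

/-- Here ρ is the rejection probability, κ the integral of h² over rejected draws and D = |Z - 1| at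
the initial state. The top powers of D from w² and w⁴ are paired with the crude bounds ρ ≤ 1 and κ ≤
g0, the constant parts with the small bounds. Thus h² meets at most D² and no power of D exceeds 4,
which the available moments cover. -/
lemma corrBound_ge {V g0 g1 d1 h D ρ κ w : ℝ} (hV : 0 ≤ V)
    (hρ0 : 0 ≤ ρ) (hκ0 : 0 ≤ κ) (hρ1 : ρ ≤ 1) (hρ : ρ ≤ D + d1) (hκ1 : κ ≤ g0)
    (hκ : κ ≤ D * g0 + g1) (hw0 : 0 ≤ w) (hw : w ≤ D + (2 + V)) :
    2 * h ^ 2 * (ρ * (8 * w ^ 2)) + 2 * (96 * w ^ 4 * κ) ≤ corrBound V g0 g1 d1 h D := by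
  have b0 : 0 ≤ 2 + V := by linarith
  set b := 2 + V with hb
  have w2 : w ^ 2 ≤ 2 * D ^ 2 + 2 * b ^ 2 := by
    have : w ^ 2 ≤ (D + b) ^ 2 := pow_le_pow_left₀ hw0 hw 2
    nlinarith [sq_nonneg (D - b)]
  have w4 : w ^ 4 ≤ 8 * D ^ 4 + 8 * b ^ 4 := by
    have : w ^ 4 ≤ (2 * D ^ 2 + 2 * b ^ 2) ^ 2 := by
      rw [show w ^ 4 = (w ^ 2) ^ 2 by ring]; exact pow_le_pow_left₀ (sq_nonneg w) w2 2
    nlinarith [sq_nonneg (D ^ 2 - b ^ 2)]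
  have e1 : ρ * w ^ 2 ≤ 2 * D ^ 2 + 2 * b ^ 2 * (D + d1) := by
    calc ρ * w ^ 2 ≤ ρ * (2 * D ^ 2 + 2 * b ^ 2) := by gcongr
      _ = ρ * (2 * D ^ 2) + 2 * b ^ 2 * ρ := by ring
      _ ≤ 1 * (2 * D ^ 2) + 2 * b ^ 2 * (D + d1) := by gcongr
      _ = _ := by ring
  have e2 : w ^ 4 * κ ≤ 8 * (g0 * D ^ 4) + 8 * b ^ 4 * (D * g0 + g1) := by
    calc w ^ 4 * κ ≤ (8 * D ^ 4 + 8 * b ^ 4) * κ := by gcongr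
      _ = 8 * D ^ 4 * κ + 8 * b ^ 4 * κ := by ring
      _ ≤ 8 * D ^ 4 * g0 + 8 * b ^ 4 * (D * g0 + g1) := by gcongr
      _ = _ := by ring
  have e3 := mul_le_mul_of_nonneg_left e1 (sq_nonneg h)
  unfold corrBound
  rw [← hb]
  nlinarith

namespace MomentConditions

variable {q : Measure X} [IsProbabilityMeasure q] {ω f : X → ℝ} {c r : ℝ} {k : ℕ}
  (H : MomentConditions q ω f c r k) {N : ℕ}

include H

lemma ae_steps_pos (hN : 1 ≤ N) : ∀ᵐ d ∂(stepsLaw q N), ∀ i, 0 < zHat ω (d i).1 := by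
  refine ae_all_iff.2 fun i => ?_
  have h1 : ∀ᵐ e ∂(stepLaw q N), 0 < zHat ω e.1 :=
    Measure.quasiMeasurePreserving_fst.ae (H.ae_zHat_pos hN)
  exact (measurePreserving_eval_infinitePi (fun _ : ℕ => stepLaw q N) i).quasiMeasurePreserving.ae
    h1

lemma exists_variance_bound : ∃ V : ℝ, 0 ≤ V ∧ ∀ N : ℕ, 1 ≤ N →
    ∫ d : Fin N → X, (zHat ω d - 1) ^ 2 ∂(qBar q N) ≤ V := by
  obtain ⟨C, hC, hb⟩ := H.exists_zHat_moment_bound (j := 1) (by linarith [H.two_le])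
  refine ⟨C, hC, fun N hN => (hb N hN).trans (mul_le_of_le_one_right hC ?_)⟩
  rw [pow_one]
  exact inv_le_one_of_one_le₀ (by exact_mod_cast hN)

lemma measure_rejSet_lt_one (hN : 1 ≤ N) {x : Fin N → X} (hx : 0 < zHat ω x) :
    stepLaw q N (rejSet ω x) < 1 := by
  obtain ⟨V, hV0, hV⟩ := H.exists_variance_bound
  refine (H.measure_rejSet_le_one_sub hN hx (hV N hN)).trans_lt ?_
  rw [ENNReal.ofReal_lt_one]
  have : 0 < 3 / (4 * (zHat ω x + (1 + V))) := by positivity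
  linarith

/-- Rejection of the first t independent draws has probability ρ^t, with ρ < 1. -/
lemma ae_exists_notMem (hN : 1 ≤ N) {x : Fin N → X} (hx : 0 < zHat ω x) :
    ∀ᵐ d ∂(stepsLaw q N), ∃ s, d s ∉ rejSet ω x := by
  have h1 : ∀ t : ℕ, stepsLaw q N {d | ¬ ∃ s, d s ∉ rejSet ω x} ≤
      stepLaw q N (rejSet ω x) ^ t := by
    intro t
    calc _ ≤ stepsLaw q N (Set.pi (Finset.range t) fun _ => rejSet ω x) :=
          measure_mono fun d hd i _ => not_not.1 (not_exists.1 hd i)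
      _ = _ := by
          rw [Measure.infinitePi_pi _ fun _ _ => measurableSet_rejSet H.meas_ω x]
          simp
  exact le_antisymm (ge_of_tendsto'
    (ENNReal.tendsto_pow_atTop_nhds_zero_of_lt_one (H.measure_rejSet_lt_one hN hx)) h1) bot_le

/-- The second moment of the bias correction given the initial state. -/
lemma lintegral_steps_sq_le (hN : 1 ≤ N) {x : Fin N → X} (hx : 0 < zHat ω x) {V : ℝ}
    (hV : ∫ d : Fin N → X, (zHat ω d - 1) ^ 2 ∂(qBar q N) ≤ V) :
    ∫⁻ d, ENNReal.ofReal ((uis ω f (x, d) - fHat ω f x) ^ 2) ∂(stepsLaw q N) ≤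
      ENNReal.ofReal (corrBound V (∫ d : Fin N → X, (fHat ω f d - c) ^ 2 ∂(qBar q N))
        (∫ d : Fin N → X, (fHat ω f d - c) ^ 2 * |zHat ω d - 1| ∂(qBar q N))
        (∫ d : Fin N → X, |zHat ω d - 1| ∂(qBar q N)) (fHat ω f x - c) |zHat ω x - 1|) := by
  have hV0 : 0 ≤ V := le_trans (integral_nonneg fun _ => sq_nonneg _) hV
  have m1 := measurable_fHat H.meas_ω H.meas_f N
  have hR := measurableSet_rejSet H.meas_ω x
  set R := rejSet ω x
  set ρ := stepLaw q N R with hρ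
  set gG : (Fin N → X) × unitInterval → ℝ≥0∞ :=
    fun e => ENNReal.ofReal ((fHat ω f e.1 - c) ^ 2) with hgG
  have mG : Measurable gG := by fun_prop
  set κ := ∫⁻ e in R, gG e ∂(stepLaw q N) with hκ
  set w := zHat ω x + (1 + V) with hw
  have hw0 : 0 < w := by positivity
  have mA := fun t => measurable_allIn (E := (Fin N → X) × unitInterval) hR t
  have mT1 : ∀ t : ℕ, Measurable fun d => (2 * (t : ℝ≥0∞) + 1) * allIn R t d :=
    fun t => (mA t).const_mul _
  have mAG : ∀ t j : ℕ, Measurable fun d => allIn R t d * gG (d j) :=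
    fun t j => (mA t).mul (mG.comp (measurable_pi_apply j))
  have mT2 : ∀ t : ℕ, Measurable fun d =>
      ((t : ℝ≥0∞) + 1) ^ 2 * ∑ j ∈ Finset.range (t + 1), allIn R t d * gG (d j) :=
    fun t => (Finset.measurable_fun_sum _ fun j _ => mAG t j).const_mul _
  have ha0 : 0 < 3 / (4 * w) := by positivity
  have ha1 : 3 / (4 * w) ≤ 1 := by rw [div_le_one (by positivity)]; linarith
  have hρ1 : ρ ≤ ENNReal.ofReal (1 - 3 / (4 * w)) := H.measure_rejSet_le_one_sub hN hx hV
  have step1 : ∫⁻ d, ENNReal.ofReal ((uis ω f (x, d) - fHat ω f x) ^ 2) ∂(stepsLaw q N) ≤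
      2 * ENNReal.ofReal ((fHat ω f x - c) ^ 2) * (ρ * ENNReal.ofReal (8 * w ^ 2)) +
        2 * (ENNReal.ofReal (96 * w ^ 4) * κ) := by
    calc _ ≤ ∫⁻ d, (2 * ENNReal.ofReal ((fHat ω f x - c) ^ 2) *
          (∑' t : ℕ, (2 * (t : ℝ≥0∞) + 1) * allIn R t d) +
          2 * ∑' t : ℕ, ((t : ℝ≥0∞) + 1) ^ 2 * ∑ j ∈ Finset.range (t + 1),
            allIn R t d * gG (d j)) ∂(stepsLaw q N) := by
          refine lintegral_mono_ae ?_
          filter_upwards [H.ae_steps_pos hN, H.ae_exists_notMem hN hx] with d h1 h2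
          exact ofReal_sq_uis_sub_le (z := (x, d)) hx h1 h2 c
      _ = 2 * ENNReal.ofReal ((fHat ω f x - c) ^ 2) *
          (∑' t : ℕ, (2 * (t : ℝ≥0∞) + 1) * ρ ^ (t + 1)) +
          2 * ∑' t : ℕ, ((t : ℝ≥0∞) + 1) ^ 2 * ∑ j ∈ Finset.range (t + 1), ρ ^ t * κ := by
          rw [lintegral_add_left ((Measurable.tsum mT1).const_mul _),
            lintegral_const_mul _ (Measurable.tsum mT1),
            lintegral_const_mul _ (Measurable.tsum mT2),
            lintegral_tsum fun t => (mT1 t).aemeasurable,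
            lintegral_tsum fun t => (mT2 t).aemeasurable]
          refine congrArg₂ (· + ·) (congrArg _ (tsum_congr fun t => ?_))
            (congrArg _ (tsum_congr fun t => ?_))
          · rw [lintegral_const_mul _ (mA t), lintegral_allIn hR]
          · rw [lintegral_const_mul _ (Finset.measurable_fun_sum _ fun j _ => mAG t j),
              lintegral_finsetSum _ fun j _ => mAG t j]
            congr 1
            exact Finset.sum_congr rfl fun j hj => lintegral_allIn_mul hR mG hj
      -- The t + 1 summands in j are equal, which turns (t+1)² into (t+1)³.
      _ = 2 * ENNReal.ofReal ((fHat ω f x - c) ^ 2) *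
          (∑' t : ℕ, (2 * (t : ℝ≥0∞) + 1) * ρ ^ (t + 1)) +
          2 * ((∑' t : ℕ, ((t : ℝ≥0∞) + 1) ^ 3 * ρ ^ t) * κ) := by
          rw [← ENNReal.tsum_mul_right]
          congr 3
          ext t
          simp only [Finset.sum_const, Finset.card_range, nsmul_eq_mul]
          push_cast
          ring
      _ ≤ 2 * ENNReal.ofReal ((fHat ω f x - c) ^ 2) *
          (ρ * ENNReal.ofReal (2 / (3 / (4 * w)) ^ 2)) +
          2 * (ENNReal.ofReal (6 / (3 / (4 * w)) ^ 4) * κ) := by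
          gcongr
          · exact tsum_linear_mul_pow_le ha0 ha1 hρ1
          · exact tsum_cube_mul_pow_le ha0 ha1 hρ1
      _ ≤ _ := by
          gcongr
          · have : 2 / (3 / (4 * w)) ^ 2 = 32 / 9 * w ^ 2 := by field_simp; norm_num
            rw [this]
            nlinarith [sq_nonneg w]
          · have : 6 / (3 / (4 * w)) ^ 4 = 1536 / 81 * w ^ 4 := by field_simp; norm_num
            rw [this]
            nlinarith [pow_pos hw0 4]
  have d10 : 0 ≤ ∫ d : Fin N → X, |zHat ω d - 1| ∂(qBar q N) :=
    integral_nonneg fun _ => abs_nonneg _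
  have g00 : 0 ≤ ∫ d : Fin N → X, (fHat ω f d - c) ^ 2 ∂(qBar q N) :=
    integral_nonneg fun _ => sq_nonneg _
  have g10 : 0 ≤ ∫ d : Fin N → X, (fHat ω f d - c) ^ 2 * |zHat ω d - 1| ∂(qBar q N) :=
    integral_nonneg fun _ => by positivity
  have hκ1 := H.setLIntegral_rejSet_err_le hN hx
  have hκ2 := H.setLIntegral_rejSet_err_le_abs hN hx
  have hρ2 := H.measure_rejSet_le_abs hN hx
  have eρ : ρ = ENNReal.ofReal ρ.toReal := (ENNReal.ofReal_toReal (measure_ne_top _ _)).symm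
  have eκ : κ = ENNReal.ofReal κ.toReal :=
    (ENNReal.ofReal_toReal (ne_top_of_le_ne_top ENNReal.ofReal_ne_top hκ1)).symm
  refine step1.trans ?_
  rw [eρ, eκ, ← ENNReal.ofReal_ofNat, ← ENNReal.ofReal_mul zero_le_two,
    ← ENNReal.ofReal_mul ENNReal.toReal_nonneg, ← ENNReal.ofReal_mul (by positivity),
    ← ENNReal.ofReal_mul (by positivity), ← ENNReal.ofReal_mul zero_le_two,
    ← ENNReal.ofReal_add (by positivity) (by positivity)]
  refine ENNReal.ofReal_le_ofReal (corrBound_ge hV0 ENNReal.toReal_nonneg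
    ENNReal.toReal_nonneg ?_ ?_ ?_ ?_ hw0.le ?_)
  · exact ENNReal.toReal_le_of_le_ofReal zero_le_one (by simpa using prob_le_one)
  · exact ENNReal.toReal_le_of_le_ofReal (by positivity) hρ2
  · exact ENNReal.toReal_le_of_le_ofReal g00 hκ1
  · exact ENNReal.toReal_le_of_le_ofReal (by positivity) hκ2
  · have := le_abs_self (zHat ω x - 1)
    linarith

/-- The draws for which the estimator has no degenerate value and the chains meet. -/
lemma ae_draws_good (hN : 1 ≤ N) : ∀ᵐ z ∂(drawsLaw q N), 0 < zHat ω z.1 ∧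
    (∀ i, 0 < zHat ω (z.2 i).1) ∧ ∃ s, z.2 s ∉ rejSet ω z.1 := by
  have m := measurable_zHat H.meas_ω N
  have hS : MeasurableSet {z : Draws X N | ∃ s, z.2 s ∉ rejSet ω z.1} := by
    have : {z : Draws X N | ∃ s, z.2 s ∉ rejSet ω z.1} =
        ⋃ s, {z : Draws X N | zHat ω (z.2 s).1 / zHat ω z.1 ≤ ((z.2 s).2 : ℝ)}ᶜ := by
      ext z; simp [rejSet]
    rw [this]
    exact MeasurableSet.iUnion fun s =>
      (measurableSet_le (by fun_prop) (by fun_prop)).compl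
  have h1 : ∀ᵐ z ∂(drawsLaw q N), 0 < zHat ω z.1 :=
    Measure.quasiMeasurePreserving_fst.ae (H.ae_zHat_pos hN)
  have h2 : ∀ᵐ z ∂(drawsLaw q N), ∀ i, 0 < zHat ω (z.2 i).1 :=
    Measure.quasiMeasurePreserving_snd.ae (H.ae_steps_pos hN)
  have h3 : ∀ᵐ z ∂(drawsLaw q N), ∃ s, z.2 s ∉ rejSet ω z.1 :=
    (Measure.ae_prod_mem_iff_ae_ae_mem hS).2
      ((H.ae_zHat_pos hN).mono fun x hx => H.ae_exists_notMem hN hx)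
  filter_upwards [h1, h2, h3] with z a b c using ⟨a, b, c⟩

lemma ae_exists_meet (hN : 1 ≤ N) :
    ∀ᵐ z ∂(drawsLaw q N), ∃ s, (laggedPair ω z s).1 = (laggedPair ω z s).2 := by
  classical
  filter_upwards [H.ae_draws_good hN] with z ⟨h0, hd, hex⟩
  exact ⟨Nat.find hex, laggedPair_eq_of_notMem h0 hd
    (fun i hi => not_not.1 (Nat.find_min hex hi)) (Nat.find_spec hex)⟩

lemma ae_meetingTime_lt_top (hN : 1 ≤ N) : ∀ᵐ z ∂(drawsLaw q N), meetingTime ω z < ⊤ :=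
  (H.ae_exists_meet hN).mono fun _ ⟨_, hs⟩ => meetingTime_lt_top hs

/-- The event that the chains coincide need not be measurable in a general space. The estimator is
instead an almost sure limit of measurable truncated sums, which are eventually constant. -/
lemma aemeasurable_uis (hN : 1 ≤ N) :
    AEMeasurable (fun z : Draws X N => uis ω f z) (drawsLaw q N) := by
  have m1 := measurable_fHat H.meas_ω H.meas_f N
  have mp := fun t => measurable_laggedPair H.meas_ω (N := N) t
  refine aemeasurable_of_tendsto_metrizable_ae atTop (f := fun s (z : Draws X N) =>
    fHat ω f z.1 + ∑ t ∈ Finset.range s,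
      (fHat ω f (laggedPair ω z t).1 - fHat ω f (laggedPair ω z t).2))
    (fun s => ((m1.comp measurable_fst).add (Finset.measurable_fun_sum _ fun t _ =>
      (m1.comp (mp t).fst).sub (m1.comp (mp t).snd))).aemeasurable) ?_
  filter_upwards [H.ae_exists_meet hN] with z ⟨s, hs⟩
  refine tendsto_const_nhds.congr' ?_
  filter_upwards [eventually_ge_atTop s] with t ht
  exact uis_eq (laggedPair_eq_of_le hs ht)

end MomentConditions

end UIS

/-! ### Asymptotic mean squared error of the unbiased estimator. -/

namespace UIS

open ProbabilityTheory

variable {X : Type*} [MeasurableSpace X]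

namespace MomentConditions

variable {q : Measure X} [IsProbabilityMeasure q] {ω f : X → ℝ} {c r : ℝ} {k : ℕ}
  (H : MomentConditions q ω f c r k) {N : ℕ}

include H

/-- The second moment of the bias correction, in terms of moments of the estimation errors. -/
lemma lintegral_sq_uis_sub_le (hN : 1 ≤ N) {V : ℝ}
    (hV : ∫ d : Fin N → X, (zHat ω d - 1) ^ 2 ∂(qBar q N) ≤ V) :
    ∫⁻ z, ENNReal.ofReal ((uis ω f z - fHat ω f z.1) ^ 2) ∂(drawsLaw q N) ≤
      ENNReal.ofReal (
        32 * (∫ x : Fin N → X, (fHat ω f x - c) ^ 2 * (zHat ω x - 1) ^ 2 ∂(qBar q N)) +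
        32 * (2 + V) ^ 2 *
          ((∫ x : Fin N → X, (fHat ω f x - c) ^ 2 * |zHat ω x - 1| ∂(qBar q N)) +
            (∫ x : Fin N → X, |zHat ω x - 1| ∂(qBar q N)) *
              ∫ x : Fin N → X, (fHat ω f x - c) ^ 2 ∂(qBar q N)) +
        1536 * ((∫ x : Fin N → X, (fHat ω f x - c) ^ 2 ∂(qBar q N)) *
            (∫ x : Fin N → X, (zHat ω x - 1) ^ 4 ∂(qBar q N)) +
          (2 + V) ^ 4 * ((∫ x : Fin N → X, (fHat ω f x - c) ^ 2 ∂(qBar q N)) *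
              (∫ x : Fin N → X, |zHat ω x - 1| ∂(qBar q N)) +
            ∫ x : Fin N → X, (fHat ω f x - c) ^ 2 * |zHat ω x - 1| ∂(qBar q N)))) := by
  have hV0 : 0 ≤ V := le_trans (integral_nonneg fun _ => sq_nonneg _) hV
  have h2 := H.two_le
  have i0 := H.integrable_err_sq hN
  have i1 := H.integrable_err_sq_mul_abs hN
  have i2 := H.integrable_err_sq_mul_sq hN
  have j1 := H.integrable_abs_zHat hN
  have j4 : Integrable (fun x : Fin N → X => (zHat ω x - 1) ^ 4) (qBar q N) :=
    H.integrable_zHat_pow hN (by omega)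
  set g0 := ∫ x : Fin N → X, (fHat ω f x - c) ^ 2 ∂(qBar q N)
  set g1 := ∫ x : Fin N → X, (fHat ω f x - c) ^ 2 * |zHat ω x - 1| ∂(qBar q N)
  set d1 := ∫ x : Fin N → X, |zHat ω x - 1| ∂(qBar q N)
  have g00 : 0 ≤ g0 := integral_nonneg fun _ => sq_nonneg _
  have g10 : 0 ≤ g1 := integral_nonneg fun _ => by positivity
  have d10 : 0 ≤ d1 := integral_nonneg fun _ => abs_nonneg _
  have e : ∀ x : Fin N → X, corrBound V g0 g1 d1 (fHat ω f x - c) |zHat ω x - 1| =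
      32 * ((fHat ω f x - c) ^ 2 * (zHat ω x - 1) ^ 2) +
      (32 * (2 + V) ^ 2 * ((fHat ω f x - c) ^ 2 * |zHat ω x - 1| + d1 * (fHat ω f x - c) ^ 2) +
      1536 * (g0 * (zHat ω x - 1) ^ 4 + (2 + V) ^ 4 * (g0 * |zHat ω x - 1| + g1))) := by
    intro x
    rw [corrBound, sq_abs, Even.pow_abs (by decide), add_assoc]
  have k1 : Integrable (fun x : Fin N → X =>
      (fHat ω f x - c) ^ 2 * |zHat ω x - 1| + d1 * (fHat ω f x - c) ^ 2) (qBar q N) :=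
    i1.add (i0.const_mul _)
  have k2 : Integrable (fun x : Fin N → X => g0 * |zHat ω x - 1| + g1) (qBar q N) :=
    (j1.const_mul _).add (integrable_const _)
  have k3 : Integrable (fun x : Fin N → X =>
      g0 * (zHat ω x - 1) ^ 4 + (2 + V) ^ 4 * (g0 * |zHat ω x - 1| + g1)) (qBar q N) :=
    (j4.const_mul _).add (k2.const_mul _)
  have k4 : Integrable (fun x : Fin N → X => 32 * (2 + V) ^ 2 *
      ((fHat ω f x - c) ^ 2 * |zHat ω x - 1| + d1 * (fHat ω f x - c) ^ 2) +
      1536 * (g0 * (zHat ω x - 1) ^ 4 + (2 + V) ^ 4 * (g0 * |zHat ω x - 1| + g1)))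
      (qBar q N) := (k1.const_mul _).add (k3.const_mul _)
  have hint : Integrable (fun x : Fin N → X =>
      corrBound V g0 g1 d1 (fHat ω f x - c) |zHat ω x - 1|) (qBar q N) := by
    simp only [e]
    exact (i2.const_mul 32).add k4
  calc _ ≤ ∫⁻ x, ∫⁻ d, ENNReal.ofReal ((uis ω f (x, d) - fHat ω f x) ^ 2) ∂(stepsLaw q N)
          ∂(qBar q N) := lintegral_prod_le _
    _ ≤ ∫⁻ x, ENNReal.ofReal (corrBound V g0 g1 d1 (fHat ω f x - c) |zHat ω x - 1|)
          ∂(qBar q N) :=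
        lintegral_mono_ae ((H.ae_zHat_pos hN).mono fun x hx => H.lintegral_steps_sq_le hN hx hV)
    _ = ENNReal.ofReal (∫ x : Fin N → X,
          corrBound V g0 g1 d1 (fHat ω f x - c) |zHat ω x - 1| ∂(qBar q N)) :=
        (ofReal_integral_eq_lintegral_ofReal hint (Eventually.of_forall fun x => by
          unfold corrBound; positivity)).symm
    _ = _ := by
        congr 1
        simp only [e]
        rw [integral_add (i2.const_mul 32) k4, integral_add (k1.const_mul _) (k3.const_mul _), integral_const_mul,
          integral_const_mul, integral_const_mul, integral_add i1 (i0.const_mul _),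
          integral_add (j4.const_mul _) (k2.const_mul _), integral_const_mul, integral_const_mul,
          integral_const_mul, integral_add (j1.const_mul _) (integrable_const _),
          integral_const_mul, integral_const, probReal_univ, one_smul, add_assoc]

lemma aemeasurable_uis_sub (hN : 1 ≤ N) :
    AEMeasurable (fun z : Draws X N => uis ω f z - fHat ω f z.1) (drawsLaw q N) :=
  (H.aemeasurable_uis hN).sub
    ((measurable_fHat H.meas_ω H.meas_f N).comp measurable_fst).aemeasurable

lemma memLp_uis_sub (hN : 1 ≤ N) :
    MemLp (fun z : Draws X N => uis ω f z - fHat ω f z.1) 2 (drawsLaw q N) := by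
  obtain ⟨V, -, hV⟩ := H.exists_variance_bound
  have hm := H.aemeasurable_uis_sub hN
  refine (memLp_two_iff_integrable_sq hm.aestronglyMeasurable).2
    ⟨(hm.pow_const 2).aestronglyMeasurable, ?_⟩
  rw [hasFiniteIntegral_iff_ofReal (Eventually.of_forall fun _ => sq_nonneg _)]
  exact (H.lintegral_sq_uis_sub_le hN (hV N hN)).trans_lt ENNReal.ofReal_lt_top

/-- The bias correction is asymptotically negligible. -/
lemma tendsto_mul_integral_sq_uis_sub :
    Tendsto (fun N : ℕ => (N : ℝ) *
      ∫ z : Draws X N, (uis ω f z - fHat ω f z.1) ^ 2 ∂(drawsLaw q N)) atTop (𝓝 0) := by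
  obtain ⟨V, hV0, hV⟩ := H.exists_variance_bound
  have t0 := H.tendsto_mul_integral_err_sq
  have t1 := H.tendsto_mul_integral_err_sq_mul_abs
  have t2 := H.tendsto_mul_integral_err_sq_mul_sq
  have u1 := H.tendsto_integral_abs_zHat
  have u4 := H.tendsto_zHat_moment H.two_le two_ne_zero
  -- Each term is either a moment already known to be o(1/N), or the convergent N·E[h²] times a
  -- vanishing moment of Z - 1; the fourth moment is available because k ≥ 2.
  have hlim := ((t2.const_mul 32).add ((t1.add (u1.mul t0)).const_mul (32 * (2 + V) ^ 2))).add
    (((t0.mul u4).add (((t0.mul u1).add t1).const_mul ((2 + V) ^ 4))).const_mul 1536)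
  simp only [mul_zero, zero_mul, add_zero] at hlim
  refine squeeze_zero' (Eventually.of_forall fun N => mul_nonneg (Nat.cast_nonneg _)
    (integral_nonneg fun _ => sq_nonneg _)) ?_ hlim
  filter_upwards [eventually_ge_atTop 1] with N hN
  rw [integral_eq_lintegral_of_nonneg_ae (Eventually.of_forall fun _ => sq_nonneg _)
    ((H.aemeasurable_uis_sub hN).pow_const 2).aestronglyMeasurable]
  refine (mul_le_mul_of_nonneg_left (ENNReal.toReal_le_of_le_ofReal ?_
    (H.lintegral_sq_uis_sub_le hN (hV N hN))) (Nat.cast_nonneg N)).trans_eq ?_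
  · have p1 : ∀ {g : (Fin N → X) → ℝ}, (∀ x, 0 ≤ g x) → 0 ≤ ∫ x, g x ∂(qBar q N) :=
      fun h => integral_nonneg h
    have a1 := p1 fun x => sq_nonneg (fHat ω f x - c)
    have a2 := p1 fun x => abs_nonneg (zHat ω x - 1)
    have a3 := p1 fun x => mul_nonneg (sq_nonneg (fHat ω f x - c)) (abs_nonneg (zHat ω x - 1))
    have a4 := p1 fun x => mul_nonneg (sq_nonneg (fHat ω f x - c)) (sq_nonneg (zHat ω x - 1))
    have a5 := p1 fun x => Even.pow_nonneg (n := 4) (by decide) (zHat ω x - 1)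
    positivity
  · ring

lemma memLp_err_draws (hN : 1 ≤ N) :
    MemLp (fun z : Draws X N => fHat ω f z.1 - c) 2 (drawsLaw q N) :=
  (H.memLp_err hN).comp_measurePreserving measurePreserving_fst

lemma integrable_sq_uis_sub_const (hN : 1 ≤ N) :
    Integrable (fun z : Draws X N => (uis ω f z - c) ^ 2) (drawsLaw q N) := by
  have := ((H.memLp_err_draws hN).add (H.memLp_uis_sub hN)).integrable_sq
  refine this.congr (Eventually.of_forall fun z => ?_)
  simp only [Pi.add_apply]
  ring

/-- The unbiased estimator has the asymptotic mean squared error of importance sampling. -/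
lemma tendsto_mul_integral_sq_uis_sub_const :
    Tendsto (fun N : ℕ => (N : ℝ) *
      ∫ z : Draws X N, (uis ω f z - c) ^ 2 ∂(drawsLaw q N)) atTop
      (𝓝 (∫ x, (ω x * (f x - c)) ^ 2 ∂q)) := by
  have key := tendsto_mul_integral_add_sq (μ := fun N => drawsLaw q N) (c := fun N => (N : ℝ))
    (fun N => Nat.cast_nonneg N)
    (A := fun N z => fHat ω f z.1 - c) (E := fun N z => uis ω f z - fHat ω f z.1)
    (L := ∫ x, (ω x * (f x - c)) ^ 2 ∂q)
    ((eventually_ge_atTop 1).mono fun _ => H.memLp_err_draws)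
    ((eventually_ge_atTop 1).mono fun _ => H.memLp_uis_sub) ?_ H.tendsto_mul_integral_sq_uis_sub
  · refine key.congr fun N => ?_
    congr 2
    ext z
    ring
  · refine H.tendsto_mul_integral_err_sq.congr fun N => ?_
    have m1 := measurable_fHat H.meas_ω H.meas_f N
    congr 1
    have := integral_map (μ := drawsLaw q N) (φ := Prod.fst) measurable_fst.aemeasurable
      (f := fun x : Fin N → X => (fHat ω f x - c) ^ 2)
      ((m1.sub_const c).pow_const 2).aestronglyMeasurable
    rw [← this]
    congr 1
    exact (measurePreserving_fst (μ := qBar q N)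
      (ν := Measure.infinitePi fun _ : ℕ => stepLaw q N)).map_eq.symm

end MomentConditions

/-! ### Choice of exponents and reduction to the moment conditions. -/

lemma exists_exponents {p r : ℝ} (hr : 2 < r) (h : 2 * p + 4 * r + 4 < r * p) :
    ∃ k : ℕ, 2 ≤ k ∧ (2 * k : ℝ) ≤ p ∧ r + 2 < k * (r - 2) := by
  have hp : 4 < p := by nlinarith
  have h1 : (⌊p / 2⌋₊ : ℝ) ≤ p / 2 := Nat.floor_le (by linarith)
  have h2 := Nat.lt_floor_add_one (p / 2)
  -- The hypothesis says (p/2)(r-2) > 2r + 2, and rounding p/2 down costs less than r - 2, so k(r-2)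
  -- > r + 4.
  refine ⟨⌊p / 2⌋₊, Nat.le_floor (by push_cast; linarith), by linarith, ?_⟩
  nlinarith

lemma memLp_of_integrable_rpow {q : Measure X} {g : X → ℝ} (hg : Measurable g) {r : ℝ}
    (hr : 0 < r) (h : Integrable (fun x => |g x| ^ r) q) : MemLp g (ENNReal.ofReal r) q := by
  refine (integrable_norm_rpow_iff hg.aestronglyMeasurable (by simpa using hr)
    ENNReal.ofReal_ne_top).1 ?_
  simpa [ENNReal.toReal_ofReal hr.le] using h

/-- The change of measure gives q(ω) = 1 and q(ωf) = π(f), so both ω - 1 and ω(f - π(f)) are centred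
under q. -/
lemma exists_momentConditions {π q : Measure X} [IsProbabilityMeasure π] [IsProbabilityMeasure q]
    (hπq : π ≪ q) {ω : X → ℝ} (hω_meas : Measurable ω)
    (hω : ω =ᵐ[q] fun x => (π.rnDeriv q x).toReal) (hω_pos : ∀ᵐ x ∂q, 0 < ω x)
    {f : X → ℝ} (hf_meas : Measurable f) {p r : ℝ} (hr : 2 < r)
    (hω_mom : Integrable (fun x => ω x ^ p) q)
    (hfω : Integrable (fun x => f x ^ 2 * ω x ^ 2) q)
    (hf : Integrable (fun x => |f x| ^ r) q) (h : 2 * p + 4 * r + 4 < r * p) :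
    ∃ k : ℕ, MomentConditions q ω f (∫ x, f x ∂π) r k := by
  obtain ⟨k, hk2, hkp, hgap⟩ := exists_exponents hr h
  have hp : 4 < p := by nlinarith
  have Lω : MemLp ω ((2 * k : ℕ) : ℝ≥0∞) q := by
    refine (memLp_of_integrable_rpow hω_meas (r := p) (by linarith)
      (hω_mom.congr ?_)).mono_exponent ?_
    · filter_upwards [hω_pos] with x hx
      rw [abs_of_pos hx]
    · rw [← ENNReal.ofReal_natCast]
      exact ENNReal.ofReal_le_ofReal (by push_cast; exact hkp)
  have Lω2 : MemLp ω 2 q := Lω.mono_exponent (by exact_mod_cast (by omega : 2 ≤ 2 * k))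
  have Lωf : MemLp (fun x => ω x * f x) 2 q := by
    refine (memLp_two_iff_integrable_sq (hω_meas.mul hf_meas).aestronglyMeasurable).2 ?_
    exact hfω.congr (Eventually.of_forall fun x => by simp only [Pi.mul_apply]; ring)
  have v1 : ∫ x, ω x ∂q = 1 := by
    have := integral_toReal_rnDeriv_mul hπq (f := fun _ => (1 : ℝ))
    rw [integral_congr_ae hω]
    simpa using this
  have v2 : ∫ x, ω x * f x ∂q = ∫ x, f x ∂π := by
    rw [← integral_toReal_rnDeriv_mul hπq]
    exact integral_congr_ae (hω.mono fun x hx => by simp only [hx])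
  set c := ∫ x, f x ∂π
  have iω := Lω2.integrable one_le_two
  have iωf : Integrable (fun x => ω x * f x) q := Lωf.integrable one_le_two
  have e : (fun x => ω x * (f x - c)) = fun x => ω x * f x - c * ω x := by ext x; ring
  refine ⟨k, hω_meas, hf_meas, hω_pos, ?_, Lω.sub (memLp_const 1), ?_, ?_, ?_, hk2, hr, hgap⟩
  · rw [integral_sub iω (integrable_const 1), v1]
    simp
  · rw [e]
    exact Lωf.sub (Lω2.const_mul c)
  · rw [e, integral_sub iωf (iω.const_mul c), integral_const_mul, v1, v2, mul_one, sub_self]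
  · have L := (memLp_of_integrable_rpow hf_meas (by linarith) hf).sub (memLp_const c)
    have := (integrable_norm_rpow_iff L.1 (by simpa using (by linarith : 0 < r))
      ENNReal.ofReal_ne_top).2 L
    simpa [ENNReal.toReal_ofReal (by linarith : 0 ≤ r)] using this

/-- A bounded function satisfies the moment condition for some finite exponent. -/
lemma exists_rpow_of_bounded {q : Measure X} [IsProbabilityMeasure q] {f : X → ℝ}
    (hf : Measurable f) {M : ℝ} (hM : ∀ᵐ x ∂q, |f x| ≤ M) {p : ℝ} (hp : 4 < p) :
    ∃ r : ℝ, 2 < r ∧ Integrable (fun x => |f x| ^ r) q ∧ 2 * p + 4 * r + 4 < r * p := by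
  have hp4 : 0 < p - 4 := by linarith
  have h0 : 0 < (2 * p + 4) / (p - 4) := by positivity
  -- The condition on r reads r(p-4) > 2p + 4; adding 3 makes it strict and ensures r > 2.
  refine ⟨(2 * p + 4) / (p - 4) + 3, by linarith, ?_, ?_⟩
  · refine (integrable_const (M ^ ((2 * p + 4) / (p - 4) + 3))).mono'
      (hf.abs.pow_const _).aestronglyMeasurable (hM.mono fun x hx => ?_)
    rw [Real.norm_of_nonneg (by positivity)]
    exact Real.rpow_le_rpow (abs_nonneg _) hx (by linarith)
  · have : (2 * p + 4) / (p - 4) * (p - 4) = 2 * p + 4 := div_mul_cancel₀ _ hp4.ne'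
    nlinarith

end UIS

theorem mainTheorem11 {X : Type*} [MeasurableSpace X]
    (π q : Measure X) [IsProbabilityMeasure π] [IsProbabilityMeasure q] (hπq : π ≪ q)
    (ω : X → ℝ) (hω_meas : Measurable ω)
    (hω : ω =ᵐ[q] fun x => (π.rnDeriv q x).toReal)
    (hω_pos : ∀ᵐ x ∂q, 0 < ω x)
    (f : X → ℝ) (hf_meas : Measurable f)
    (p : ℝ) (hp : 2 < p) (hω_mom : Integrable (fun x => ω x ^ p) q)
    (hfω : Integrable (fun x => f x ^ 2 * ω x ^ 2) q)
    (hf_mom :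
      (∃ r : ℝ, 2 < r ∧ Integrable (fun x => |f x| ^ r) q ∧ 2 * p + 4 * r + 4 < r * p) ∨
      ((∃ M : ℝ, ∀ᵐ x ∂q, |f x| ≤ M) ∧ 4 < p)) :
    (∀ N : ℕ, 1 ≤ N →
      (∀ᵐ z ∂(UIS.drawsLaw q N), UIS.meetingTime ω z < ⊤) ∧
      Integrable (fun z => (UIS.uis ω f z - ∫ x, f x ∂π) ^ 2) (UIS.drawsLaw q N) ∧
      Integrable (fun x => (UIS.fHat ω f x - ∫ x, f x ∂π) ^ 2) (UIS.qBar q N)) ∧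
    ∃ L : ℝ,
      Tendsto (fun N : ℕ => (N : ℝ) *
        ∫ z, (UIS.uis ω f z - ∫ x, f x ∂π) ^ 2 ∂(UIS.drawsLaw q N)) atTop (𝓝 L) ∧
      Tendsto (fun N : ℕ => (N : ℝ) *
        ∫ x, (UIS.fHat ω f x - ∫ x, f x ∂π) ^ 2 ∂(UIS.qBar q N)) atTop (𝓝 L) := by
  obtain ⟨r, hr, hf, h⟩ : ∃ r : ℝ, 2 < r ∧ Integrable (fun x => |f x| ^ r) q ∧
      2 * p + 4 * r + 4 < r * p := by
    rcases hf_mom with h | ⟨⟨M, hM⟩, h4⟩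
    · exact h
    · exact UIS.exists_rpow_of_bounded hf_meas hM h4
  obtain ⟨k, H⟩ := UIS.exists_momentConditions hπq hω_meas hω hω_pos hf_meas hr hω_mom hfω hf h
  exact ⟨fun N hN => ⟨H.ae_meetingTime_lt_top hN, H.integrable_sq_uis_sub_const hN,
    H.integrable_err_sq hN⟩, _, H.tendsto_mul_integral_sq_uis_sub_const,
    H.tendsto_mul_integral_err_sq⟩
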